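/- Let $N\ge 1$. Let $A$ be an $N\times N$ GUE matrix, i.e. a random complex Hermitian matrix whose independent entries (the real diagonal entries and the complex entries above the diagonal) have joint density proportional to $e^{-\mathrm{Tr}\,A^2}$ with respect to Lebesgue measure. For $\alpha>0$ consider either of the two random matrices $$A+i\alpha\,\mathrm{diag}(1,0,\dots,0),\qquad A+i\alpha\,\hat{\mathbf 1}\hat{\mathbf 1}^\dagger,\qquad \hat{\mathbf 1}:=N^{-1/2}(1,\dots,1)^T .$$ Then there is a constant $C_N>0$, depending only on $N$ (in particular not on $\alpha$, and the same for both matrices), such that for every $\alpha>0$ the unordered eigenvalues $z_l=x_l+iy_l$ ($l=1,\dots,N$), counted with algebraic multiplicity, have joint law given by the permutation-invariant probability measure on $\mathbb C^N$ $$C_N\prod_{l=1}^N e^{-(x_l^2-y_l^2)}\prod_{1\le j<k\le N}|z_k-z_j|^2\;\frac{e^{-\alpha^2}}{\alpha^{N-1}}\;\delta\Big(\alpha-\sum_{l=1}^N y_l\Big)\prod_{l=1}^N dx_l\,dy_l ,$$ supported on $y_l>0$ for all $l=1,\dots,N$. Here $\delta(\alpha-\sum_l y_l)\prod_l dy_l$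 is the measure on the hyperplane $\sum_l y_l=\alpha$ obtained by integrating out one of the variables $y_l$ against the delta function; that the law is the above measure means that for every measurable symmetric function $f\ge 0$ on $\mathbb C^N$ the expectation of $f(z_1,\dots,z_N)$ is the integral of $f$ against it. -/

import Mathlib

open MeasureTheory ProbabilityTheory

noncomputable section

namespace PerturbedGUE

/-- The independent entries of an `N × N` Hermitian matrix: the real diagonal entries and the
complex entries strictly above the diagonal. This is a product of copies of `ℝ` and `ℂ`, and carries
the product Lebesgue measure `volume`. -/
abbrev HermitianEntries (N : ℕ) : Type :=
  (Fin N → ℝ) × ({p : Fin N × Fin N // p.1 < p.2} → ℂ)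

/-- The Hermitian matrix with the given independent entries. -/
def hermitianOfEntries (N : ℕ) (h : HermitianEntries N) : Matrix (Fin N) (Fin N) ℂ :=
  Matrix.of fun i j =>
    if hij : i < j then h.2 ⟨(i, j), hij⟩
    else if hji : j < i then star (h.2 ⟨(j, i), hji⟩)
    else (h.1 i : ℂ)

/-- The measure `exp (-Tr A²) dA` on the independent entries of an `N × N` Hermitian matrix `A`
(not normalised; the trace of `A²` is real). -/
def gueWeight (N : ℕ) : Measure (HermitianEntries N) :=
  volume.withDensity fun h =>
    ENNReal.ofReal
      (Real.exp (-(Matrix.trace (hermitianOfEntries N h * hermitianOfEntries N h)).re))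

/-- The law of the entries of a GUE matrix: the probability measure proportional to
`exp (-Tr A²) dA`. -/
def gueEntriesLaw (N : ℕ) : Measure (HermitianEntries N) :=
  (gueWeight N Set.univ)⁻¹ • gueWeight N

/-- `A` is a GUE random matrix on the probability space `(Ω, P)`: its entries above and on the
diagonal have the joint law proportional to `exp (-Tr A²) dA`, the remaining ones being determined
by Hermitian symmetry. -/
def IsGUE {Ω : Type*} [MeasurableSpace Ω] (N : ℕ) (A : Ω → Matrix (Fin N) (Fin N) ℂ)
    (P : Measure Ω) : Prop :=
  ∃ h : Ω → HermitianEntries N,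
    HasLaw h (gueEntriesLaw N) P ∧ ∀ ω, A ω = hermitianOfEntries N (h ω)

/-- The matrix `diag (1, 0, …, 0)`. -/
def diagOne (N : ℕ) [NeZero N] : Matrix (Fin N) (Fin N) ℂ :=
  Matrix.diagonal fun i => if i = 0 then 1 else 0

/-- The unit column vector in `ℂ^N` with all entries equal, i.e. equal to `1 / √N`. -/
def unitOnes (N : ℕ) : Fin N → ℂ := fun _ => ((1 / Real.sqrt N : ℝ) : ℂ)

/-- The rank one projection `v v†` for the column vector `v` with all entries equal to `1 / √N`. -/
def onesProjection (N : ℕ) : Matrix (Fin N) (Fin N) ℂ :=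
  Matrix.vecMulVec (unitOnes N) (star (unitOnes N))

/-- The measure `δ (α - ∑ y_l) dy_0 ⋯ dy_{N-1}` on `ℝ^N`: the variable `y_0` is integrated against
the delta function and so equals `α - ∑_{l ≠ 0} y_l`, while the variables `y_l` with `l ≠ 0` carry
Lebesgue measure. -/
def deltaSum (N : ℕ) [NeZero N] (α : ℝ) : Measure (Fin N → ℝ) :=
  (volume : Measure ({l : Fin N // l ≠ 0} → ℝ)).map fun y l =>
    if hl : l = 0 then α - ∑ k, y k else y ⟨l, hl⟩

/-- The measure `δ (α - ∑ y_l) ∏ dx_l dy_l` on `ℂ^N`, where `z_l = x_l + i y_l`. -/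
def deltaSumIm (N : ℕ) [NeZero N] (α : ℝ) : Measure (Fin N → ℂ) :=
  ((volume : Measure (Fin N → ℝ)).prod (deltaSum N α)).map fun p l => (⟨p.1 l, p.2 l⟩ : ℂ)

/-- The function `∏ exp (-(x_l² - y_l²)) ∏_{j < k} |z_k - z_j|² exp (-α²) / α^(N-1)`. -/
def eigenvalueWeight (N : ℕ) (α : ℝ) (z : Fin N → ℂ) : ℝ :=
  (∏ l, Real.exp (-((z l).re ^ 2 - (z l).im ^ 2))) *
    (∏ j, ∏ k ∈ Finset.Ioi j, ‖z k - z j‖ ^ 2) *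
      (Real.exp (-α ^ 2) / α ^ (N - 1))

/-- The measure on `ℂ^N` supported on `y_l > 0` for all `l`, with density `C * eigenvalueWeight N α`
with respect to `δ (α - ∑ y_l) ∏ dx_l dy_l`. -/
def eigenvalueMeasure (N : ℕ) [NeZero N] (C α : ℝ) : Measure (Fin N → ℂ) :=
  ((deltaSumIm N α).restrict {z | ∀ l, 0 < (z l).im}).withDensity fun z =>
    ENNReal.ofReal (C * eigenvalueWeight N α z)

/-- `μ` is the joint law of the (unordered) eigenvalues, counted with algebraic multiplicity, of the
random matrix `M`: `μ` is invariant under permutations of the coordinates, and for every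
enumeration `z ω` of the eigenvalues of `M ω` and every symmetric measurable test function `f` the
expectation of `f (z_1, …, z_N)` is the integral of `f` against `μ`. -/
structure IsEigenvalueLaw {Ω : Type*} [MeasurableSpace Ω] {N : ℕ}
    (M : Ω → Matrix (Fin N) (Fin N) ℂ) (P : Measure Ω) (μ : Measure (Fin N → ℂ)) : Prop where
  symmetric : ∀ σ : Equiv.Perm (Fin N), μ.map (fun z => z ∘ σ) = μ
  lintegral_eq : ∀ z : Ω → Fin N → ℂ,
    (∀ ω, (M ω).charpoly.roots = Finset.univ.val.map (z ω)) →
    ∀ f : (Fin N → ℂ) → ENNReal, Measurable f →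
      (∀ (σ : Equiv.Perm (Fin N)) (w : Fin N → ℂ), f (w ∘ σ) = f w) →
      ∫⁻ ω, f (z ω) ∂P = ∫⁻ w, f w ∂μ

end PerturbedGUE

end

/-!
For a Hermitian matrix `A` and a unit vector `v`, the matrix `A + iα v v†` has the characteristic
polynomial `p - iαq`, where `p` is the characteristic polynomial of `A` and
`q = v† adj (X - A) v` is real and monic of degree `N - 1`. Lebesgue measure on the Hermitian
matrices is carried to a multiple of Lebesgue measure on the coefficients of the pairs `(p, q)`
whose roots strictly interlace: by unitary invariance `v` may be taken to be `e₁`, and then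
bordering a Hermitian matrix by a row and a column is one step `p = (X - a) q - r q'` of the
Euclidean algorithm run backwards, so the claim follows by induction on `N`. By the Hermite–Biehler
theorem, `p` and `q` interlace strictly exactly when all roots `z` of `p - iαq` lie in the upper
half plane, and these roots determine `p` and `q`. Passing from the coefficients to the roots, of
fixed sum `∑ y = α` in the imaginary direction, contributes the Jacobian `∏ |z_k - z_j|²`, while
`Tr A² = ∑ (x² - y²) + α²` turns the Gaussian density into a function of the roots.
-/

namespace PerturbedGUE

section RankOne

open Matrix Polynomial

variable {R m : Type*} [CommRing R] [Fintype m] [DecidableEq m]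

theorem det_fromBlocks_corner (d : R) (u w : m → R) (M : Matrix m m R) :
    (fromBlocks (of fun _ _ : Unit => d) (replicateRow Unit w) (replicateCol Unit u) M).det =
      (d - 1) * M.det + (M - vecMulVec u w).det := by
  set B := fromBlocks (1 : Matrix Unit Unit R) (replicateRow Unit w) (replicateCol Unit u) M
    with hB
  have h_row : fromBlocks (of fun _ _ : Unit => d) (replicateRow Unit w) (replicateCol Unit u) M =
      B.updateRow (Sum.inl ()) (B (Sum.inl ()) +
        (d - 1) • (Sum.elim (fun _ => 1) 0 : Unit ⊕ m → R)) := by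
    ext (i | i) (j | j) <;> simp [hB, updateRow_apply]
  have h_unit : B.updateRow (Sum.inl ()) (Sum.elim (fun _ => 1) 0 : Unit ⊕ m → R) =
      fromBlocks (1 : Matrix Unit Unit R) 0 (replicateCol Unit u) M := by
    ext (i | i) (j | j) <;> simp [hB, updateRow_apply]
  rw [h_row, det_updateRow_add, det_updateRow_smul, h_unit, updateRow_eq_self, hB,
    det_fromBlocks_one₁₁, det_fromBlocks_zero₁₂, add_comm, vecMulVec_eq Unit, det_one, one_mul]

theorem det_sub_smul_vecMulVec (t : R) (u w : m → R) (M : Matrix m m R) :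
    (M - t • vecMulVec u w).det = M.det - t * (M.det - (M - vecMulVec u w).det) := by
  have h_row : fromBlocks (of fun _ _ : Unit => t) (replicateRow Unit (t • w))
      (replicateCol Unit u) M =
      updateRow (fromBlocks (of fun _ _ : Unit => 1) (replicateRow Unit w) (replicateCol Unit u) M)
        (Sum.inl ()) (t • Sum.elim (fun _ => 1) w) := by
    ext (i | i) (j | j) <;> simp [updateRow_apply]
  have h_self : updateRow (fromBlocks (of fun _ _ : Unit => (1 : R)) (replicateRow Unit w)
      (replicateCol Unit u) M) (Sum.inl ()) (Sum.elim (fun _ => 1) w) =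
      fromBlocks (of fun _ _ : Unit => 1) (replicateRow Unit w) (replicateCol Unit u) M := by
    ext (i | i) (j | j) <;> simp [updateRow_apply]
  -- The bordered determinant is linear in its first row `(d, w)`; compare `(t, t w)` with `(1, w)`.
  have h_scale := congrArg det h_row
  rw [det_updateRow_smul, h_self, det_fromBlocks_corner, det_fromBlocks_corner,
    vecMulVec_smul] at h_scale
  linear_combination h_scale

theorem charmatrix_add_smul_vecMulVec (t : R) (u w : m → R) (A : Matrix m m R) :
    charmatrix (A + t • vecMulVec u w) =
      charmatrix A - C t • vecMulVec (fun i => C (u i)) (fun i => C (w i)) := by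
  ext1 i j
  simp only [charmatrix, scalar_apply, map_add, RingHom.mapMatrix_apply, Matrix.sub_apply,
    Matrix.add_apply, map_apply, Matrix.smul_apply, vecMulVec_apply, smul_eq_mul, C_mul]
  ring

theorem charmatrix_add_vecMulVec (u w : m → R) (A : Matrix m m R) :
    charmatrix (A + vecMulVec u w) =
      charmatrix A - vecMulVec (fun i => C (u i)) (fun i => C (w i)) := by
  simpa only [one_smul, C_1] using charmatrix_add_smul_vecMulVec 1 u w A

theorem charpoly_add_smul_vecMulVec (t : R) (u w : m → R) (A : Matrix m m R) :
    (A + t • vecMulVec u w).charpoly =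
      A.charpoly - C t * (A.charpoly - (A + vecMulVec u w).charpoly) := by
  simp only [charpoly, charmatrix_add_smul_vecMulVec, det_sub_smul_vecMulVec,
    charmatrix_add_vecMulVec]

theorem charpoly_fin_succ {n : ℕ} (A : Matrix (Fin (n + 1)) (Fin (n + 1)) R) :
    A.charpoly = (X - C (A 0 0) - 1) * (A.submatrix Fin.succ Fin.succ).charpoly +
      (A.submatrix Fin.succ Fin.succ +
        vecMulVec (fun i : Fin n => A i.succ 0) (fun j : Fin n => A 0 j.succ)).charpoly := by
  let e : Unit ⊕ Fin n ≃ Fin (n + 1) :=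
    ((Equiv.sumComm Unit (Fin n)).trans (Equiv.optionEquivSumPUnit (Fin n)).symm).trans
      (finSuccEquiv n).symm
  have h_blocks : (charmatrix A).submatrix e e =
      fromBlocks (of fun _ _ : Unit => X - C (A 0 0))
        (replicateRow Unit fun j : Fin n => - C (A 0 j.succ))
        (replicateCol Unit fun i : Fin n => - C (A i.succ 0))
        (charmatrix (A.submatrix Fin.succ Fin.succ)) := by
    ext1 (i | i) (j | j) <;>
      simp [e, charmatrix, diagonal_apply, (Fin.succ_ne_zero _).symm]
  have h_signs : vecMulVec (fun i : Fin n => - C (A i.succ 0)) (fun j : Fin n => - C (A 0 j.succ)) =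
      vecMulVec (fun i : Fin n => C (A i.succ 0)) (fun j : Fin n => C (A 0 j.succ)) := by
    ext1 i j
    simp only [vecMulVec_apply, neg_mul_neg]
  rw [charpoly, ← det_submatrix_equiv_self e, h_blocks, det_fromBlocks_corner, h_signs,
    ← charmatrix_add_vecMulVec]
  rfl

/-- The polynomial `b† adj (X - A) b`, written as the change of the characteristic polynomial under
the rank one perturbation `A + b b†`. Divided by `A.charpoly` it is the resolvent entry
`b† (X - A)⁻¹ b`. -/
noncomputable def resolventPoly (A : Matrix m m ℂ) (b : m → ℂ) : ℂ[X] :=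
  A.charpoly - (A + vecMulVec b (star b)).charpoly

theorem charpoly_add_smul_vecMulVec_star (t : ℂ) (b : m → ℂ) (A : Matrix m m ℂ) :
    (A + t • vecMulVec b (star b)).charpoly = A.charpoly - C t * resolventPoly A b :=
  charpoly_add_smul_vecMulVec t b (star b) A

theorem resolventPoly_smul (t : ℂ) (b : m → ℂ) (A : Matrix m m ℂ) :
    resolventPoly A (t • b) = C (t * star t) * resolventPoly A b := by
  rw [resolventPoly, star_smul, smul_vecMulVec, vecMulVec_smul, smul_smul,
    charpoly_add_smul_vecMulVec_star]
  ring

theorem resolventPoly_single {n : ℕ} (A : Matrix (Fin (n + 1)) (Fin (n + 1)) ℂ) :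
    resolventPoly A (Pi.single 0 1) = (A.submatrix Fin.succ Fin.succ).charpoly := by
  have h_minor : (A + vecMulVec (Pi.single 0 1) (star (Pi.single 0 1 : Fin (n + 1) → ℂ))).submatrix
      Fin.succ Fin.succ = A.submatrix Fin.succ Fin.succ := by
    ext i j
    simp [vecMulVec_apply]
  rw [resolventPoly, charpoly_fin_succ A, charpoly_fin_succ (A + _), h_minor]
  simp [vecMulVec_apply]
  ring

theorem charpoly_fin_succ_of_isHermitian {n : ℕ} {A : Matrix (Fin (n + 1)) (Fin (n + 1)) ℂ}
    (hA : A.IsHermitian) :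
    A.charpoly = (X - C (A 0 0)) * (A.submatrix Fin.succ Fin.succ).charpoly -
      resolventPoly (A.submatrix Fin.succ Fin.succ) (fun i => A i.succ 0) := by
  have h_row : (fun j : Fin n => A 0 j.succ) = star (fun i : Fin n => A i.succ 0) := by
    ext j
    exact (hA.apply 0 j.succ).symm
  rw [charpoly_fin_succ, resolventPoly, h_row]
  ring

theorem charpoly_conj_involution {U : Matrix m m R} (hU : U * U = 1) (A : Matrix m m R) :
    (U * A * U).charpoly = A.charpoly := by
  rw [charpoly_mul_comm, ← Matrix.mul_assoc, hU, Matrix.one_mul]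

theorem resolventPoly_conj_involution {U : Matrix m m ℂ} (hU : U * U = 1) (hH : U.IsHermitian)
    (A : Matrix m m ℂ) (b : m → ℂ) :
    resolventPoly (U * A * U) (U *ᵥ b) = resolventPoly A b := by
  have h_conj : U * A * U + vecMulVec (U *ᵥ b) (star (U *ᵥ b)) =
      U * (A + vecMulVec b (star b)) * U := by
    rw [Matrix.mul_add, Matrix.add_mul, star_mulVec, hH.eq, ← mul_vecMulVec, ← vecMulVec_mul,
      Matrix.mul_assoc U (vecMulVec b _)]
  rw [resolventPoly, h_conj, charpoly_conj_involution hU, charpoly_conj_involution hU,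
    resolventPoly]

theorem isHermitian_vecMulVec_star {ι : Type*} (b : ι → ℂ) :
    (vecMulVec b (star b)).IsHermitian := by
  ext i j
  simp [vecMulVec_apply, mul_comm]

theorem im_coeff_charpoly_of_isHermitian {A : Matrix m m ℂ} (hA : A.IsHermitian) (k : ℕ) :
    (A.charpoly.coeff k).im = 0 := by
  have h_conj : A.charpoly.map (starRingEnd ℂ) = A.charpoly := by
    rw [← charpoly_map, ← charpoly_transpose]
    exact congrArg charpoly hA
  rw [← Complex.conj_eq_iff_im, ← coeff_map, h_conj]

theorem im_coeff_resolventPoly_of_isHermitian {A : Matrix m m ℂ} (hA : A.IsHermitian)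
    (b : m → ℂ) (k : ℕ) : ((resolventPoly A b).coeff k).im = 0 := by
  rw [resolventPoly, coeff_sub, Complex.sub_im, im_coeff_charpoly_of_isHermitian hA,
    im_coeff_charpoly_of_isHermitian (hA.add (isHermitian_vecMulVec_star b)), sub_zero]

theorem coeff_resolventPoly_of_lt {n : ℕ} (A : Matrix (Fin (n + 1)) (Fin (n + 1)) ℂ)
    (b : Fin (n + 1) → ℂ) {k : ℕ} (hk : n < k) : (resolventPoly A b).coeff k = 0 := by
  have h_degree := degree_sub_lt_left (p := A.charpoly) (q := (A + vecMulVec b (star b)).charpoly)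
    (by simp only [charpoly_degree_eq_dim]) (charpoly_monic A).ne_zero
    (by rw [(charpoly_monic A).leadingCoeff, (charpoly_monic _).leadingCoeff])
  rw [charpoly_degree_eq_dim, Fintype.card_fin] at h_degree
  exact coeff_eq_zero_of_degree_lt (h_degree.trans_le (by exact_mod_cast hk))

theorem coeff_resolventPoly {n : ℕ} (A : Matrix (Fin (n + 1)) (Fin (n + 1)) ℂ)
    (b : Fin (n + 1) → ℂ) : (resolventPoly A b).coeff n = b ⬝ᵥ star b := by
  have h_trace := trace_eq_neg_charpoly_coeff A
  have h_trace_add := trace_eq_neg_charpoly_coeff (A + vecMulVec b (star b))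
  rw [trace_add, trace_vecMulVec] at h_trace_add
  simp only [Fintype.card_fin, Nat.add_sub_cancel] at h_trace h_trace_add
  rw [resolventPoly, coeff_sub]
  linear_combination h_trace - h_trace_add

end RankOne

section Reflection

open Matrix

variable {m : Type*} [Fintype m]

/-- The squared Euclidean length of a complex vector. -/
noncomputable def sqLength (b : m → ℂ) : ℝ := ∑ i, ‖b i‖ ^ 2

theorem dotProduct_star_self (b : m → ℂ) : b ⬝ᵥ star b = (sqLength b : ℂ) := by
  simp [dotProduct, sqLength, Complex.mul_conj']

theorem star_dotProduct_self (b : m → ℂ) : star b ⬝ᵥ b = (sqLength b : ℂ) := by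
  rw [dotProduct_comm, dotProduct_star_self]

theorem sqLength_smul (c : ℂ) (b : m → ℂ) : sqLength (c • b) = ‖c‖ ^ 2 * sqLength b := by
  simp [sqLength, mul_pow, Finset.mul_sum]

theorem sqLength_pos {b : m → ℂ} (hb : b ≠ 0) : 0 < sqLength b := by
  obtain ⟨i, hi⟩ := Function.ne_iff.mp hb
  exact Finset.sum_pos' (fun i _ => by positivity)
    ⟨i, Finset.mem_univ _, pow_pos (norm_pos_iff.mpr hi) 2⟩

theorem star_dotProduct_self_ne_zero {b : m → ℂ} (hb : b ≠ 0) : star b ⬝ᵥ b ≠ 0 := by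
  rw [star_dotProduct_self]
  exact_mod_cast (sqLength_pos hb).ne'

variable [DecidableEq m]

/-- The reflection `1 - 2 u u† / (u† u)` in the hyperplane orthogonal to `u`. For `u = 0` the
division by zero makes it the identity, so that `householder (v - w)` exchanges `v` and `w` also
when they are equal. -/
noncomputable def householder (u : m → ℂ) : Matrix m m ℂ :=
  1 - (2 / (star u ⬝ᵥ u)) • vecMulVec u (star u)

theorem householder_mul_self (u : m → ℂ) : householder u * householder u = 1 := by
  rcases eq_or_ne u 0 with rfl | hu
  · simp [householder]
  have h_sq : vecMulVec u (star u) * vecMulVec u (star u) =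
      (star u ⬝ᵥ u) • vecMulVec u (star u) := by
    rw [vecMulVec_mul_vecMulVec, vecMulVec_smul]
  simp only [householder, Matrix.sub_mul, Matrix.mul_sub, Matrix.one_mul, Matrix.mul_one,
    Matrix.smul_mul, Matrix.mul_smul, h_sq, smul_smul,
    div_mul_cancel₀ _ (star_dotProduct_self_ne_zero hu)]
  module

theorem isHermitian_householder (u : m → ℂ) : (householder u).IsHermitian := by
  have h_real : star (2 / (star u ⬝ᵥ u)) = 2 / (star u ⬝ᵥ u) := by
    rw [star_dotProduct_self]
    simp
  rw [householder, IsHermitian, conjTranspose_sub, conjTranspose_one, conjTranspose_smul, h_real,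
    (isHermitian_vecMulVec_star u).eq]

theorem householder_sub_mulVec {v w : m → ℂ} (h_length : sqLength v = sqLength w)
    (h_real : star w ⬝ᵥ v = star v ⬝ᵥ w) : householder (v - w) *ᵥ w = v := by
  rcases eq_or_ne v w with rfl | h
  · simp [householder]
  have h_ne : star (v - w) ⬝ᵥ (v - w) ≠ 0 :=
    star_dotProduct_self_ne_zero (sub_ne_zero.mpr h)
  have h_vv : star v ⬝ᵥ v = star w ⬝ᵥ w := by
    rw [star_dotProduct_self, h_length, star_dotProduct_self]
  have h_inner : star (v - w) ⬝ᵥ w * 2 = -(star (v - w) ⬝ᵥ (v - w)) := by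
    simp only [star_sub, sub_dotProduct, dotProduct_sub]
    linear_combination h_vv - h_real
  have h_coeff : 2 / (star (v - w) ⬝ᵥ (v - w)) * (star (v - w) ⬝ᵥ w) = -1 := by
    field_simp
    linear_combination h_inner
  rw [householder, sub_mulVec, one_mulVec, smul_mulVec, vecMulVec_mulVec, op_smul_eq_smul,
    smul_smul, h_coeff]
  module

theorem exists_involution_mulVec_single {n : ℕ} {v : Fin (n + 1) → ℂ} (hv : v ≠ 0) :
    ∃ (U : Matrix (Fin (n + 1)) (Fin (n + 1)) ℂ) (c : ℂ), U * U = 1 ∧ U.IsHermitian ∧ c ≠ 0 ∧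
      U *ᵥ (c • Pi.single 0 1) = v := by
  -- The phase of `c` makes the inner product of `c e₀` and `v` real, as a reflection requires.
  obtain ⟨θ, hθ, hv0⟩ : ∃ θ : ℂ, ‖θ‖ = 1 ∧ v 0 = ‖v 0‖ * θ :=
    ⟨_, Complex.norm_exp_ofReal_mul_I _, (Complex.norm_mul_exp_arg_mul_I (v 0)).symm⟩
  have hr : 0 < √(sqLength v) := Real.sqrt_pos.mpr (sqLength_pos hv)
  set c : ℂ := √(sqLength v) * θ with hc
  have h_norm : ‖c‖ = √(sqLength v) := by rw [hc, norm_mul, hθ, mul_one, Complex.norm_real,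
    Real.norm_of_nonneg hr.le]
  refine ⟨householder (v - c • Pi.single 0 1), c, householder_mul_self _,
    isHermitian_householder _, norm_pos_iff.mp (h_norm ▸ hr), householder_sub_mulVec ?_ ?_⟩
  · rw [sqLength_smul, h_norm, Real.sq_sqrt (sqLength_pos hv).le]
    simp [sqLength, Pi.single_apply, apply_ite]
  · rw [star_smul, ← Pi.single_star, smul_dotProduct, dotProduct_smul, dotProduct_single,
      single_dotProduct, hc, Pi.star_apply, hv0]
    simp
    ring

end Reflection

section MonicPoly

open Polynomial

variable {R : Type*} [CommRing R] {n : ℕ}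

/-- The monic polynomial of degree `n` with the given lower coefficients. It identifies the monic
polynomials of degree `n` with the space `Fin n → R` on which coefficients are integrated. -/
noncomputable def monicPoly (c : Fin n → R) : R[X] :=
  X ^ n + ∑ i : Fin n, C (c i) * X ^ (i : ℕ)

theorem coeff_monicPoly (c : Fin n → R) (k : ℕ) :
    (monicPoly c).coeff k = if h : k < n then c ⟨k, h⟩ else if k = n then 1 else 0 := by
  simp only [monicPoly, coeff_add, coeff_X_pow, finsetSum_coeff, coeff_C_mul, mul_ite, mul_one,
    mul_zero]
  by_cases hk : k < n
  · rw [if_neg hk.ne, dif_pos hk, zero_add, Finset.sum_eq_single ⟨k, hk⟩]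
    · simp
    · rintro j - hj
      exact if_neg fun h => hj (Fin.ext h.symm)
    · simp
  · rw [dif_neg hk, Finset.sum_eq_zero, add_zero]
    rintro j -
    exact if_neg (by omega)

@[simp] theorem coeff_monicPoly_fin (c : Fin n → R) (i : Fin n) : (monicPoly c).coeff i = c i := by
  simp [coeff_monicPoly]

@[simp] theorem coeff_monicPoly_self (c : Fin n → R) : (monicPoly c).coeff n = 1 := by
  simp [coeff_monicPoly]

theorem isMonicOfDegree_monicPoly [Nontrivial R] (c : Fin n → R) :
    IsMonicOfDegree (monicPoly c) n := by
  refine (isMonicOfDegree_iff _ _).mpr ⟨natDegree_le_iff_coeff_eq_zero.mpr fun k hk => ?_, ?_⟩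
  · rw [coeff_monicPoly, dif_neg hk.not_gt, if_neg hk.ne']
  · exact coeff_monicPoly_self c

theorem monicPoly_coeff [Nontrivial R] {P : R[X]} (hP : IsMonicOfDegree P n) :
    monicPoly (fun i : Fin n => P.coeff i) = P := by
  ext k
  rcases lt_trichotomy k n with hk | rfl | hk
  · exact coeff_monicPoly_fin _ ⟨k, hk⟩
  · rw [coeff_monicPoly_self, ((isMonicOfDegree_iff _ _).mp hP).2]
  · rw [coeff_eq_zero_of_natDegree_lt ((isMonicOfDegree_monicPoly _).natDegree_eq.trans_lt hk),
      coeff_eq_zero_of_natDegree_lt (hP.natDegree_eq.trans_lt hk)]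

theorem map_monicPoly {S : Type*} [CommRing S] (f : R →+* S) (c : Fin n → R) :
    (monicPoly c).map f = monicPoly (fun i => f (c i)) := by
  simp [monicPoly, Polynomial.map_sum]

theorem monicPoly_injective : Function.Injective (monicPoly : (Fin n → R) → R[X]) := by
  intro c d h
  ext i
  rw [← coeff_monicPoly_fin c, h, coeff_monicPoly_fin]

theorem eq_and_eq_of_C_mul_monicPoly_eq [IsDomain R] {r₁ r₂ : R} {c₁ c₂ : Fin n → R}
    (hr : r₁ ≠ 0) (h : C r₁ * monicPoly c₁ = C r₂ * monicPoly c₂) : r₁ = r₂ ∧ c₁ = c₂ := by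
  have h_lead := congrArg (coeff · n) h
  simp only [coeff_C_mul, coeff_monicPoly_self, mul_one] at h_lead
  subst h_lead
  exact ⟨rfl, monicPoly_injective (mul_left_cancel₀ (C_ne_zero.mpr hr) h)⟩

end MonicPoly

section Interlaced

open Polynomial

/-- The coefficients of `(X - a) q - r q'`: one step of the Euclidean algorithm, run backwards. -/
noncomputable def euclidStep {n : ℕ} (a r : ℝ) (q : Fin (n + 1) → ℝ) (q' : Fin n → ℝ) :
    Fin (n + 2) → ℝ :=
  fun i => ((X - C a) * monicPoly q - C r * monicPoly q').coeff i

/-- Strict interlacing of the roots of the real monic polynomials with coefficient vectors `p` and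
`q`, expressed through the Euclidean algorithm: all its quotients have degree one, and its negated
remainders have positive leading coefficients. -/
inductive Interlaced : (n : ℕ) → (Fin (n + 1) → ℝ) → (Fin n → ℝ) → Prop
  | zero (p : Fin 1 → ℝ) (q : Fin 0 → ℝ) : Interlaced 0 p q
  | succ {n : ℕ} {a r : ℝ} {q : Fin (n + 1) → ℝ} {q' : Fin n → ℝ} (hr : 0 < r)
      (h : Interlaced n q q') : Interlaced (n + 1) (euclidStep a r q q') q

variable {n : ℕ}

theorem monicPoly_euclidStep (a r : ℝ) (q : Fin (n + 1) → ℝ) (q' : Fin n → ℝ) :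
    monicPoly (euclidStep a r q q') = (X - C a) * monicPoly q - C r * monicPoly q' := by
  refine monicPoly_coeff (IsMonicOfDegree.sub (n := n + 2) ?_ ?_)
  · rw [show n + 2 = 1 + (n + 1) by omega]
    exact (isMonicOfDegree_X_sub_one a).mul (isMonicOfDegree_monicPoly q)
  · exact (natDegree_C_mul_le _ _).trans_lt
      ((isMonicOfDegree_monicPoly q').natDegree_eq.trans_lt (by omega))

theorem coeff_monicPoly_euclidStep (a r : ℝ) (q : Fin (n + 1) → ℝ) (q' : Fin n → ℝ) (k : ℕ) :
    (monicPoly (euclidStep a r q q')).coeff (k + 1) = (monicPoly q).coeff k -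
      a * (monicPoly q).coeff (k + 1) - r * (monicPoly q').coeff (k + 1) := by
  rw [monicPoly_euclidStep, coeff_sub, sub_mul, coeff_sub, coeff_X_mul, coeff_C_mul, coeff_C_mul]

theorem euclidStep_injective {a₁ a₂ r₁ r₂ : ℝ} (hr : r₁ ≠ 0) {q : Fin (n + 1) → ℝ}
    {q₁ q₂ : Fin n → ℝ} (h : euclidStep a₁ r₁ q q₁ = euclidStep a₂ r₂ q q₂) :
    a₁ = a₂ ∧ r₁ = r₂ ∧ q₁ = q₂ := by
  have h_poly := congrArg monicPoly h
  have h_above (c : Fin n → ℝ) : (monicPoly c).coeff (n + 1) = 0 :=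
    coeff_eq_zero_of_natDegree_lt (by rw [(isMonicOfDegree_monicPoly c).natDegree_eq]; omega)
  have h_top := congrArg (coeff · (n + 1)) h_poly
  simp only [coeff_monicPoly_euclidStep, coeff_monicPoly_self, h_above] at h_top
  obtain rfl : a₁ = a₂ := by linarith
  simp only [monicPoly_euclidStep, sub_right_inj] at h_poly
  exact ⟨rfl, eq_and_eq_of_C_mul_monicPoly_eq hr h_poly⟩

theorem interlaced_euclidStep_iff {a r : ℝ} {q : Fin (n + 1) → ℝ} {q' : Fin n → ℝ} :
    Interlaced (n + 1) (euclidStep a r q q') q ↔ 0 < r ∧ Interlaced n q q' := by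
  refine ⟨fun h => ?_, fun h => h.2.succ h.1⟩
  generalize hp : euclidStep a r q q' = p at h
  cases h with
  | succ hr h' =>
    obtain ⟨-, rfl, rfl⟩ := euclidStep_injective hr.ne' hp.symm
    exact ⟨hr, h'⟩

theorem aeval_monicPoly_euclidStep (a r : ℝ) (q : Fin (n + 1) → ℝ) (q' : Fin n → ℝ) (z : ℂ) :
    aeval z (monicPoly (euclidStep a r q q')) =
      (z - a) * aeval z (monicPoly q) - r * aeval z (monicPoly q') := by
  simp [monicPoly_euclidStep]

/-- In the closed lower half plane `Im (p / q) ≤ Im z`, with denominators cleared. -/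
theorem Interlaced.im_mul_conj_le {p : Fin (n + 1) → ℝ} {q : Fin n → ℝ}
    (h : Interlaced n p q) {z : ℂ} (hz : z.im ≤ 0) :
    (aeval z (monicPoly p) * star (aeval z (monicPoly q))).im ≤
      z.im * Complex.normSq (aeval z (monicPoly q)) := by
  induction h with
  | zero => simp [monicPoly]
  | @succ n a r q q' hr _ ih =>
    rw [aeval_monicPoly_euclidStep]
    set Q := aeval z (monicPoly q)
    set Q' := aeval z (monicPoly q')
    have h_step : (((z - a) * Q - r * Q') * star Q).im =
        z.im * Complex.normSq Q + r * (Q * star Q').im := by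
      simp [Complex.normSq_apply]
      ring
    have h_ih : (Q * star Q').im ≤ 0 :=
      ih.trans (mul_nonpos_of_nonpos_of_nonneg hz (Complex.normSq_nonneg _))
    rw [h_step]
    linarith [mul_nonpos_of_nonneg_of_nonpos hr.le h_ih]

theorem isCoprime_euclidStep_iff {a r : ℝ} (hr : r ≠ 0) {q : Fin (n + 1) → ℝ} {q' : Fin n → ℝ} :
    IsCoprime (monicPoly (euclidStep a r q q')) (monicPoly q) ↔
      IsCoprime (monicPoly q) (monicPoly q') := by
  rw [monicPoly_euclidStep, sub_eq_neg_add, IsCoprime.add_mul_right_left_iff, isCoprime_comm,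
    IsCoprime.neg_right_iff, isCoprime_mul_unit_left_right (isUnit_C.mpr hr.isUnit)]

theorem Interlaced.isCoprime {p : Fin (n + 1) → ℝ} {q : Fin n → ℝ} (h : Interlaced n p q) :
    IsCoprime (monicPoly p) (monicPoly q) := by
  induction h with
  | zero => simpa [monicPoly] using isCoprime_one_right
  | succ hr _ ih => exact (isCoprime_euclidStep_iff hr.ne').mpr ih

/-- Hermite–Biehler. -/
theorem Interlaced.im_pos {p : Fin (n + 1) → ℝ} {q : Fin n → ℝ} (h : Interlaced n p q) {α : ℝ}
    (hα : 0 < α) {z : ℂ}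
    (hz : aeval z (monicPoly p) = Complex.I * α * aeval z (monicPoly q)) : 0 < z.im := by
  by_contra! h_im
  have h_le := h.im_mul_conj_le h_im
  rw [hz] at h_le
  set Q := aeval z (monicPoly q)
  have h_im_mul : (Complex.I * α * Q * star Q).im = α * Complex.normSq Q := by
    simp [Complex.normSq_apply]
    ring
  have h_zero : Complex.normSq Q = 0 := by
    have h_nonneg := Complex.normSq_nonneg Q
    have := mul_nonpos_of_nonpos_of_nonneg h_im h_nonneg
    nlinarith
  rw [Complex.normSq_eq_zero] at h_zero
  rcases (isCoprime_iff_aeval_ne_zero_of_isAlgClosed ℝ ℂ _ _).mp h.isCoprime z with hp | hq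
  · exact hp (by rw [hz, h_zero, mul_zero])
  · exact hq h_zero

end Interlaced

section HermitianPairs

open Matrix Polynomial

/-- The real coefficients of the characteristic polynomial of a Hermitian matrix. -/
noncomputable def charCoeffs {n : ℕ} (A : Matrix (Fin n) (Fin n) ℂ) : Fin n → ℝ :=
  fun i => (A.charpoly.coeff i).re

/-- The real coefficients of `resolventPoly A b` for a Hermitian matrix `A`, divided by the leading
coefficient `sqLength b`; they depend on `b` only through the line it spans. -/
noncomputable def resolventCoeffs {n : ℕ} (A : Matrix (Fin (n + 1)) (Fin (n + 1)) ℂ)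
    (b : Fin (n + 1) → ℂ) : Fin n → ℝ :=
  fun i => ((resolventPoly A b).coeff i).re / sqLength b

variable {n : ℕ}

theorem map_monicPoly_charCoeffs {A : Matrix (Fin n) (Fin n) ℂ} (hA : A.IsHermitian) :
    (monicPoly (charCoeffs A)).map (algebraMap ℝ ℂ) = A.charpoly := by
  have h_monic : IsMonicOfDegree A.charpoly n :=
    ⟨by rw [charpoly_natDegree_eq_dim, Fintype.card_fin], charpoly_monic A⟩
  rw [map_monicPoly, ← monicPoly_coeff h_monic]
  congr 1
  ext i
  exact Complex.conj_eq_iff_re.mp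
    (Complex.conj_eq_iff_im.mpr (im_coeff_charpoly_of_isHermitian hA i))

theorem C_mul_map_monicPoly_resolventCoeffs {A : Matrix (Fin (n + 1)) (Fin (n + 1)) ℂ}
    (hA : A.IsHermitian) {b : Fin (n + 1) → ℂ} (hb : b ≠ 0) :
    C (sqLength b : ℂ) * (monicPoly (resolventCoeffs A b)).map (algebraMap ℝ ℂ) =
      resolventPoly A b := by
  have h_length : (sqLength b : ℂ) ≠ 0 := by exact_mod_cast (sqLength_pos hb).ne'
  ext k
  rw [coeff_C_mul, coeff_map]
  rcases lt_trichotomy k n with hk | rfl | hk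
  · have h_real : (((resolventPoly A b).coeff k).re : ℂ) = (resolventPoly A b).coeff k :=
      Complex.conj_eq_iff_re.mp
        (Complex.conj_eq_iff_im.mpr (im_coeff_resolventPoly_of_isHermitian hA b k))
    rw [coeff_monicPoly, dif_pos hk]
    simp only [resolventCoeffs, Complex.coe_algebraMap, Complex.ofReal_div, h_real]
    exact mul_div_cancel₀ _ h_length
  · rw [coeff_monicPoly_self, map_one, mul_one, coeff_resolventPoly, dotProduct_star_self]
  · rw [coeff_resolventPoly_of_lt A b hk, coeff_eq_zero_of_natDegree_lt
      ((isMonicOfDegree_monicPoly _).natDegree_eq.trans_lt hk), map_zero, mul_zero]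

theorem resolventCoeffs_smul (A : Matrix (Fin (n + 1)) (Fin (n + 1)) ℂ) {c : ℂ} (hc : c ≠ 0)
    (b : Fin (n + 1) → ℂ) : resolventCoeffs A (c • b) = resolventCoeffs A b := by
  have h_norm : ‖c‖ ^ 2 ≠ 0 := pow_ne_zero 2 (norm_ne_zero_iff.mpr hc)
  have h_scale : c * star c = ((‖c‖ ^ 2 : ℝ) : ℂ) := by
    rw [Complex.ofReal_pow]
    exact Complex.mul_conj' c
  ext i
  rw [resolventCoeffs, resolventPoly_smul, h_scale, sqLength_smul, coeff_C_mul,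
    Complex.re_ofReal_mul, mul_div_mul_left _ _ h_norm, resolventCoeffs]

theorem sqLength_single [NeZero n] : sqLength (Pi.single 0 1 : Fin n → ℂ) = 1 := by
  simp [sqLength, Pi.single_apply, apply_ite]

theorem resolventCoeffs_single (A : Matrix (Fin (n + 1)) (Fin (n + 1)) ℂ) :
    resolventCoeffs A (Pi.single 0 1) = charCoeffs (A.submatrix Fin.succ Fin.succ) := by
  ext i
  rw [resolventCoeffs, resolventPoly_single, sqLength_single, div_one, charCoeffs]

theorem sqLength_mulVec_of_involution {m : Type*} [Fintype m] [DecidableEq m] {U : Matrix m m ℂ}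
    (hU : U * U = 1) (hH : U.IsHermitian) (b : m → ℂ) : sqLength (U *ᵥ b) = sqLength b := by
  have h_inner : (sqLength (U *ᵥ b) : ℂ) = sqLength b := by
    rw [← star_dotProduct_self, ← star_dotProduct_self, star_mulVec, hH.eq, dotProduct_mulVec,
      vecMul_vecMul, hU, vecMul_one]
  exact_mod_cast h_inner

theorem charCoeffs_conj_involution {U : Matrix (Fin n) (Fin n) ℂ} (hU : U * U = 1)
    (A : Matrix (Fin n) (Fin n) ℂ) : charCoeffs (U * A * U) = charCoeffs A := by
  ext i
  rw [charCoeffs, charpoly_conj_involution hU, charCoeffs]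

theorem resolventCoeffs_conj_involution {U : Matrix (Fin (n + 1)) (Fin (n + 1)) ℂ}
    (hU : U * U = 1) (hH : U.IsHermitian) (A : Matrix (Fin (n + 1)) (Fin (n + 1)) ℂ)
    (b : Fin (n + 1) → ℂ) : resolventCoeffs (U * A * U) (U *ᵥ b) = resolventCoeffs A b := by
  ext i
  rw [resolventCoeffs, resolventPoly_conj_involution hU hH, sqLength_mulVec_of_involution hU hH,
    resolventCoeffs]

theorem isHermitian_conj_of_isHermitian {m : Type*} [Fintype m] {U A : Matrix m m ℂ}
    (hU : U.IsHermitian) (hA : A.IsHermitian) : (U * A * U).IsHermitian := by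
  simpa only [hU.eq] using isHermitian_mul_mul_conjTranspose U hA

theorem charCoeffs_eq_euclidStep {A : Matrix (Fin (n + 2)) (Fin (n + 2)) ℂ}
    (hA : A.IsHermitian) (hb : (fun i : Fin (n + 1) => A i.succ 0) ≠ 0) :
    charCoeffs A = euclidStep (A 0 0).re (sqLength fun i : Fin (n + 1) => A i.succ 0)
      (charCoeffs (A.submatrix Fin.succ Fin.succ))
      (resolventCoeffs (A.submatrix Fin.succ Fin.succ) fun i => A i.succ 0) := by
  apply monicPoly_injective
  apply Polynomial.map_injective _ (algebraMap ℝ ℂ).injective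
  have h_corner : ((A 0 0).re : ℂ) = A 0 0 := hA.coe_re_apply_self 0
  rw [map_monicPoly_charCoeffs hA, monicPoly_euclidStep, Polynomial.map_sub, Polynomial.map_mul,
    Polynomial.map_mul, map_monicPoly_charCoeffs (hA.submatrix _), map_C, Complex.coe_algebraMap,
    C_mul_map_monicPoly_resolventCoeffs (hA.submatrix _) hb, charpoly_fin_succ_of_isHermitian hA]
  simp [h_corner]

theorem interlaced_of_isCoprime {A : Matrix (Fin (n + 1)) (Fin (n + 1)) ℂ}
    (hA : A.IsHermitian) {v : Fin (n + 1) → ℂ} (hv : v ≠ 0)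
    (h : IsCoprime (monicPoly (charCoeffs A)) (monicPoly (resolventCoeffs A v))) :
    Interlaced n (charCoeffs A) (resolventCoeffs A v) := by
  induction n with
  | zero => exact Interlaced.zero _ _
  | succ n ih =>
    obtain ⟨U, c, hU, hH, hc, hUv⟩ := exists_involution_mulVec_single hv
    set B := U * A * U with hB
    have hB_herm : B.IsHermitian := isHermitian_conj_of_isHermitian hH hA
    have hB_char : charCoeffs A = charCoeffs B := (charCoeffs_conj_involution hU A).symm
    have hB_minor : resolventCoeffs A v = charCoeffs (B.submatrix Fin.succ Fin.succ) := by
      have h_vec : U *ᵥ v = c • Pi.single 0 1 := by rw [← hUv, mulVec_mulVec, hU, one_mulVec]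
      rw [← resolventCoeffs_conj_involution hU hH, h_vec, resolventCoeffs_smul _ hc,
        resolventCoeffs_single]
    rw [hB_char, hB_minor] at h ⊢
    by_cases hb : (fun i : Fin (n + 1) => B i.succ 0) = 0
    · -- A vanishing border splits off a factor, which is then common to both polynomials.
      have h_dvd : monicPoly (charCoeffs (B.submatrix Fin.succ Fin.succ)) ∣
          monicPoly (charCoeffs B) := by
        rw [← map_dvd_map' (algebraMap ℝ ℂ), map_monicPoly_charCoeffs hB_herm,
          map_monicPoly_charCoeffs (hB_herm.submatrix _), charpoly_fin_succ_of_isHermitian hB_herm,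
          hb]
        simp [resolventPoly]
      have h_degree := natDegree_eq_zero_of_isUnit (h.isUnit_of_dvd' h_dvd dvd_rfl)
      rw [(isMonicOfDegree_monicPoly _).natDegree_eq] at h_degree
      omega
    · rw [charCoeffs_eq_euclidStep hB_herm hb] at h ⊢
      exact .succ (sqLength_pos hb) (ih (hB_herm.submatrix _) hb
        ((isCoprime_euclidStep_iff (sqLength_pos hb).ne').mp h))

/-- Livšic's triangular model. -/
theorem exists_charpoly_add_vecMulVec_eq_prod (z : Fin n → ℂ) (hz : ∀ i, 0 < (z i).im) :
    ∃ (A : Matrix (Fin n) (Fin n) ℂ) (v : Fin n → ℂ), A.IsHermitian ∧ (∀ i, v i ≠ 0) ∧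
      (A + Complex.I • vecMulVec v (star v)).charpoly = ∏ i, (X - C (z i)) := by
  set v : Fin n → ℂ := fun i => √(z i).im with hv
  have h_sq (i : Fin n) : v i * v i = (z i).im := by
    simp only [hv, ← Complex.ofReal_mul, Real.mul_self_sqrt (hz i).le]
  have h_conj (i : Fin n) : star (v i) = v i := Complex.conj_ofReal _
  set A : Matrix (Fin n) (Fin n) ℂ := of fun i j =>
    if i < j then Complex.I * v i * v j else if j < i then -(Complex.I * v i * v j)
    else ((z i).re : ℂ) with hA
  have h_upper : A + Complex.I • vecMulVec v (star v) = of fun i j =>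
      if i < j then 2 * Complex.I * v i * v j else if j < i then 0 else z i := by
    ext i j
    simp only [hA, Matrix.add_apply, of_apply, Matrix.smul_apply, vecMulVec_apply, Pi.star_apply,
      smul_eq_mul, h_conj]
    split_ifs with h_lt h_gt
    · ring
    · ring
    · obtain rfl : i = j := le_antisymm (not_lt.mp h_gt) (not_lt.mp h_lt)
      rw [h_sq, mul_comm Complex.I, Complex.re_add_im]
  refine ⟨A, v, ?_, fun i => ?_, ?_⟩
  · ext i j
    simp only [conjTranspose_apply, hA, of_apply]
    rcases lt_trichotomy i j with h | rfl | h
    · simp [h, h.asymm, h_conj, mul_right_comm]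
    · simp
    · simp [h, h.asymm, h_conj, mul_right_comm]
  · simpa [hv] using (Real.sqrt_pos.mpr (hz i)).ne'
  · rw [h_upper, charpoly_of_isUpperTriangular]
    · exact Finset.prod_congr rfl fun i _ => by simp
    · intro i j (hij : j < i)
      simp [hij, hij.le]

theorem eq_and_eq_of_map_sub_I_mul_map_eq {p₁ p₂ q₁ q₂ : ℝ[X]}
    (h : p₁.map (algebraMap ℝ ℂ) - C Complex.I * q₁.map (algebraMap ℝ ℂ) =
      p₂.map (algebraMap ℝ ℂ) - C Complex.I * q₂.map (algebraMap ℝ ℂ)) : p₁ = p₂ ∧ q₁ = q₂ := by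
  have h_coeff (k : ℕ) := congrArg (coeff · k) h
  simp only [coeff_sub, coeff_C_mul, coeff_map, Complex.coe_algebraMap] at h_coeff
  constructor <;> ext k
  · simpa using congrArg Complex.re (h_coeff k)
  · simpa using congrArg Complex.im (h_coeff k)

theorem isCoprime_of_im_pos {p q : ℝ[X]} {c : ℂ}
    (h : ∀ w : ℂ, aeval w p = c * aeval w q → 0 < w.im) : IsCoprime p q := by
  refine (isCoprime_iff_aeval_ne_zero_of_isAlgClosed ℝ ℂ p q).mpr fun w => ?_
  by_contra! hw
  have h_conj (f : ℝ[X]) (hf : aeval w f = 0) : aeval (star w) f = 0 :=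
    (aeval_conj f w).trans (by rw [hf, map_zero])
  have h_upper := h w (by rw [hw.1, hw.2, mul_zero])
  have h_lower := h (star w) (by rw [h_conj p hw.1, h_conj q hw.2, mul_zero])
  simp only [Complex.star_def, Complex.conj_im] at h_lower
  linarith

theorem interlaced_of_im_pos {p : Fin (n + 1) → ℝ} {q : Fin n → ℝ} {α : ℝ} (hα : 0 < α)
    {z : Fin (n + 1) → ℂ} (hz : ∀ i, 0 < (z i).im)
    (h : (monicPoly p).map (algebraMap ℝ ℂ) -
        C (Complex.I * α) * (monicPoly q).map (algebraMap ℝ ℂ) = ∏ i, (X - C (z i))) :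
    Interlaced n p q := by
  obtain ⟨A, v, hA, hv, hAv⟩ := exists_charpoly_add_vecMulVec_eq_prod z hz
  have hv_ne : v ≠ 0 := fun h_zero => hv 0 (congrFun h_zero 0)
  have h_pair : monicPoly p = monicPoly (charCoeffs A) ∧
      C α * monicPoly q = C (sqLength v) * monicPoly (resolventCoeffs A v) := by
    apply eq_and_eq_of_map_sub_I_mul_map_eq
    rw [Polynomial.map_mul, Polynomial.map_mul, map_C, map_C, map_monicPoly_charCoeffs hA,
      Complex.coe_algebraMap, C_mul_map_monicPoly_resolventCoeffs hA hv_ne,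
      ← charpoly_add_smul_vecMulVec_star, hAv, ← h, C_mul, mul_assoc]
  obtain rfl := monicPoly_injective h_pair.1
  obtain ⟨-, rfl⟩ := eq_and_eq_of_C_mul_monicPoly_eq hα.ne' h_pair.2
  refine interlaced_of_isCoprime hA hv_ne (isCoprime_of_im_pos (c := Complex.I * α) fun w hw => ?_)
  have h_root : (∏ i, (X - C (z i))).eval w = 0 := by
    rw [← h, eval_sub, eval_mul, eval_C, eval_map_algebraMap, eval_map_algebraMap, hw, sub_self]
  obtain ⟨i, -, hi⟩ := Finset.prod_eq_zero_iff.mp ((eval_prod _ _ _).symm.trans h_root)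
  rw [eval_sub, eval_X, eval_C, sub_eq_zero] at hi
  exact hi ▸ hz i

end HermitianPairs

section MeasureTools

open Set Module
open scoped ENNReal

section AddHaar

variable {E : Type*} [NormedAddCommGroup E] [NormedSpace ℝ E] [MeasurableSpace E] [BorelSpace E]
  [FiniteDimensional ℝ E] (μ : Measure E) [μ.IsAddHaarMeasure]

theorem measurePreserving_of_pow_eq_one {L : E →ₗ[ℝ] E} {k : ℕ} (hk : k ≠ 0) (h : L ^ k = 1) :
    MeasurePreserving L μ μ := by
  have h_det : |LinearMap.det L| = 1 := by
    refine (pow_eq_one_iff_of_nonneg (abs_nonneg _) hk).mp ?_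
    rw [← abs_pow, ← map_pow, h, map_one, abs_one]
  refine ⟨L.continuous_of_finiteDimensional.measurable, ?_⟩
  rw [Measure.map_linearMap_addHaar_eq_smul_addHaar μ (abs_ne_zero.mp (h_det ▸ one_ne_zero)),
    abs_inv, h_det]
  simp

end AddHaar

/-- The measure `|r|^n dr` on the line. -/
noncomputable def powMeasure (n : ℕ) : Measure ℝ := volume.withDensity fun r => ‖r‖ₑ ^ n

instance (n : ℕ) : SFinite (powMeasure n) := by
  unfold powMeasure; infer_instance

theorem measurePreserving_smul_right {E : Type*} [NormedAddCommGroup E] [NormedSpace ℝ E]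
    [MeasurableSpace E] [BorelSpace E] [FiniteDimensional ℝ E] (μ : Measure E)
    [μ.IsAddHaarMeasure] :
    MeasurePreserving (fun x : ℝ × E => (x.1, x.1 • x.2)) ((powMeasure (finrank ℝ E)).prod μ)
      (volume.prod μ) := by
  have h_meas : Measurable fun x : ℝ × E => (x.1, x.1 • x.2) := by fun_prop
  refine ⟨h_meas, Measure.ext fun s hs => ?_⟩
  have h_density : Measurable fun r : ℝ => ‖r‖ₑ ^ finrank ℝ E := by fun_prop
  rw [Measure.map_apply h_meas hs, Measure.prod_apply (h_meas hs), Measure.prod_apply hs,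
    powMeasure, lintegral_withDensity_eq_lintegral_mul _ h_density
      (measurable_measure_prodMk_left (h_meas hs))]
  refine lintegral_congr_ae ?_
  filter_upwards [Measure.ae_ne volume 0] with r hr
  have h_fiber : Prod.mk r ⁻¹' ((fun x : ℝ × E => (x.1, x.1 • x.2)) ⁻¹' s) =
      (r • ·) ⁻¹' (Prod.mk r ⁻¹' s) := rfl
  rw [Pi.mul_apply, h_fiber, Measure.addHaar_preimage_smul μ hr, ← mul_assoc, ← enorm_pow,
    ← Real.enorm_eq_ofReal_abs, ← enorm_mul, mul_inv_cancel₀ (pow_ne_zero _ hr), enorm_one, one_mul]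

theorem volume_sqLength_lt (n : ℕ) {s : ℝ} (hs : 0 < s) :
    volume {b : Fin n → ℂ | sqLength b < s} =
      ENNReal.ofReal (s ^ n) * volume {b : Fin n → ℂ | sqLength b < 1} := by
  have h_sqrt : 0 < √s := Real.sqrt_pos.mpr hs
  have h_preimage : {b : Fin n → ℂ | sqLength b < s} =
      ((√s)⁻¹ • ·) ⁻¹' {b | sqLength b < 1} := by
    ext b
    have h_smul : (√s)⁻¹ • b = (((√s)⁻¹ : ℝ) : ℂ) • b := by ext; simp
    rw [mem_preimage, mem_ofPred_eq, mem_ofPred_eq, h_smul, sqLength_smul, Complex.norm_real,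
      norm_inv, inv_pow, Real.norm_eq_abs, sq_abs, Real.sq_sqrt hs.le, inv_mul_lt_iff₀ hs, mul_one]
  have h_rank : finrank ℝ (Fin n → ℂ) = 2 * n := by
    rw [finrank_pi_fintype]; simp [mul_comm]
  rw [h_preimage, Measure.addHaar_preimage_smul volume (inv_ne_zero h_sqrt.ne'), h_rank, inv_pow,
    inv_inv, pow_mul, Real.sq_sqrt hs.le, abs_of_pos (pow_pos hs n)]

theorem powMeasure_restrict_Ioi_Iio (n : ℕ) {s : ℝ} (hs : 0 < s) :
    (powMeasure n).restrict (Ioi 0) (Iio s) = ENNReal.ofReal (s ^ (n + 1) / (n + 1)) := by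
  have h_enorm : EqOn (fun r : ℝ => ‖r‖ₑ ^ n) (fun r => ENNReal.ofReal (r ^ n)) (Ioo 0 s) :=
    fun r hr => by
      simp only [← ofReal_norm, Real.norm_of_nonneg hr.1.le, ENNReal.ofReal_pow hr.1.le]
  rw [Measure.restrict_apply measurableSet_Iio, Iio_inter_Ioi, powMeasure,
    withDensity_apply _ measurableSet_Ioo, setLIntegral_congr_fun measurableSet_Ioo h_enorm,
    Measure.restrict_congr_set Ioo_ae_eq_Ioc,
    ← ofReal_integral_eq_lintegral_ofReal (intervalIntegral.intervalIntegrable_pow n).1,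
    ← intervalIntegral.integral_of_le hs.le]
  · simp
  · filter_upwards [ae_restrict_mem measurableSet_Ioc] with r hr using pow_nonneg hr.1.le n

theorem continuous_sqLength (n : ℕ) : Continuous (sqLength : (Fin n → ℂ) → ℝ) := by
  unfold sqLength; fun_prop

theorem volume_sqLength_lt_one_ne_zero (n : ℕ) :
    volume {b : Fin n → ℂ | sqLength b < 1} ≠ 0 :=
  ((continuous_sqLength n).isOpen_preimage _ isOpen_Iio).measure_ne_zero volume
    ⟨0, by simp [sqLength]⟩

theorem volume_sqLength_lt_one_ne_top (n : ℕ) :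
    volume {b : Fin n → ℂ | sqLength b < 1} ≠ ∞ := by
  refine ne_top_of_le_ne_top (measure_closedBall_lt_top (x := 0) (r := 1)).ne
    (measure_mono fun b hb => ?_)
  rw [mem_closedBall_zero_iff, pi_norm_le_iff_of_nonneg zero_le_one]
  intro i
  have h_le : ‖b i‖ ^ 2 ≤ sqLength b :=
    Finset.single_le_sum (f := fun i => ‖b i‖ ^ 2) (fun _ _ => by positivity) (Finset.mem_univ i)
  exact (sq_le_one_iff₀ (norm_nonneg _)).mp (h_le.trans (le_of_lt hb))

theorem exists_measurePreserving_sqLength (n : ℕ) : ∃ κ : ℝ≥0∞, κ ≠ 0 ∧ κ ≠ ∞ ∧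
    MeasurePreserving (sqLength : (Fin (n + 1) → ℂ) → ℝ) volume
      (κ • (powMeasure n).restrict (Ioi 0)) := by
  set c : ℝ≥0∞ := volume {b : Fin (n + 1) → ℂ | sqLength b < 1}
  have hc_ne_zero : c ≠ 0 := volume_sqLength_lt_one_ne_zero _
  have hc_ne_top : c ≠ ∞ := volume_sqLength_lt_one_ne_top _
  have h_meas := (continuous_sqLength (n + 1)).measurable
  have h_map (s : ℝ) : volume.map sqLength (Iio s) =
      volume {b : Fin (n + 1) → ℂ | sqLength b < s} := Measure.map_apply h_meas measurableSet_Iio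
  refine ⟨(n + 1 : ℕ) * c, mul_ne_zero (by simp) hc_ne_zero,
    ENNReal.mul_ne_top (ENNReal.natCast_ne_top _) hc_ne_top, h_meas, ?_⟩
  refine Measure.ext_of_generateFrom_of_iUnion (range Iio) (fun k : ℕ => Iio (k + 1 : ℝ))
    (BorelSpace.measurable_eq.trans (borel_eq_generateFrom_Iio ℝ)) isPiSystem_Iio ?_
    (fun k => ⟨k + 1, rfl⟩) (fun k => ?_) ?_
  · exact iUnion_eq_univ_iff.mpr fun x => ⟨⌊x⌋₊, Nat.lt_floor_add_one x⟩
  · rw [h_map, volume_sqLength_lt _ (by positivity)]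
    exact ENNReal.mul_ne_top ENNReal.ofReal_ne_top hc_ne_top
  · rintro _ ⟨s, rfl⟩
    rw [h_map, Measure.smul_apply, smul_eq_mul]
    rcases le_or_gt s 0 with hs | hs
    · have h_empty : {b : Fin (n + 1) → ℂ | sqLength b < s} = ∅ :=
        eq_empty_of_forall_notMem fun b hb =>
          (hb.trans_le hs).not_ge (Finset.sum_nonneg fun _ _ => by positivity)
      rw [h_empty, measure_empty, Measure.restrict_apply measurableSet_Iio, Iio_inter_Ioi,
        Ioo_eq_empty (not_lt.mpr hs), measure_empty, mul_zero]
    · rw [volume_sqLength_lt _ hs, powMeasure_restrict_Ioi_Iio n hs, mul_right_comm,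
        ← ENNReal.ofReal_natCast, ← ENNReal.ofReal_mul (by positivity)]
      congr 2
      push_cast
      field_simp

variable {n : ℕ} {β : Type*} [MeasureSpace β] [SigmaFinite (volume : Measure β)]

theorem measurePreserving_finCons :
    MeasurePreserving (fun x : β × (Fin n → β) => (Fin.cons x.1 x.2 : Fin (n + 1) → β)) := by
  convert (volume_preserving_piFinSuccAbove (fun _ : Fin (n + 1) => β) 0).symm using 1
  ext x : 1
  exact (Fin.insertNth_zero' x.1 x.2).symm

theorem measurePreserving_finSnoc :
    MeasurePreserving (fun x : β × (Fin n → β) => (Fin.snoc x.2 x.1 : Fin (n + 1) → β)) := by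
  convert (volume_preserving_piFinSuccAbove (fun _ : Fin (n + 1) => β) (Fin.last n)).symm using 1
  ext x : 1
  exact (Fin.insertNth_last' x.1 x.2).symm

theorem measurePreserving_prodLeftComm {α γ δ : Type*} [MeasurableSpace α] [MeasurableSpace γ]
    [MeasurableSpace δ] (μ : Measure α) (ν : Measure γ) (ρ : Measure δ) [SFinite μ] [SFinite ν]
    [SFinite ρ] :
    MeasurePreserving (fun x : α × γ × δ => (x.2.1, x.1, x.2.2)) (μ.prod (ν.prod ρ))
      (ν.prod (μ.prod ρ)) :=
  (measurePreserving_prodAssoc ν μ ρ).comp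
    ((Measure.measurePreserving_swap.prod (MeasurePreserving.id ρ)).comp
      (measurePreserving_prodAssoc μ ν ρ).symm)

end MeasureTools

section Entries

open Matrix

variable {N : ℕ}

theorem isHermitian_hermitianOfEntries (h : HermitianEntries N) :
    (hermitianOfEntries N h).IsHermitian := by
  ext i j
  rw [conjTranspose_apply]
  simp only [hermitianOfEntries, of_apply]
  split_ifs with h1 h2 h2
  · exact absurd h1 h2.asymm
  · rfl
  · exact star_star _
  · obtain rfl : i = j := le_antisymm (not_lt.mp h1) (not_lt.mp h2)
    exact Complex.conj_ofReal _

/-- The independent entries of a matrix. It inverts `hermitianOfEntries` on Hermitian matrices. -/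
def entriesOf (A : Matrix (Fin N) (Fin N) ℂ) : HermitianEntries N :=
  (fun i => (A i i).re, fun p => A p.1.1 p.1.2)

theorem entriesOf_hermitianOfEntries (h : HermitianEntries N) :
    entriesOf (hermitianOfEntries N h) = h := by
  refine Prod.ext (funext fun i => ?_) (funext fun p => ?_)
  · simp [entriesOf, hermitianOfEntries]
  · simp [entriesOf, hermitianOfEntries, p.2]

theorem hermitianOfEntries_entriesOf {A : Matrix (Fin N) (Fin N) ℂ} (hA : A.IsHermitian) :
    hermitianOfEntries N (entriesOf A) = A := by
  ext i j
  simp only [hermitianOfEntries, entriesOf, of_apply]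
  split_ifs with h1 h2
  · rfl
  · exact hA.apply i j
  · obtain rfl : i = j := le_antisymm (not_lt.mp h2) (not_lt.mp h1)
    exact hA.coe_re_apply_self i

theorem continuous_hermitianOfEntries (N : ℕ) : Continuous (hermitianOfEntries N) := by
  refine continuous_pi fun i => continuous_pi fun j => ?_
  simp only [hermitianOfEntries, of_apply]
  split_ifs <;> fun_prop

theorem hermitianOfEntries_add (h h' : HermitianEntries N) :
    hermitianOfEntries N (h + h') = hermitianOfEntries N h + hermitianOfEntries N h' := by
  ext i j
  simp only [hermitianOfEntries, of_apply, Matrix.add_apply]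
  split_ifs <;> simp

theorem hermitianOfEntries_smul (c : ℝ) (h : HermitianEntries N) :
    hermitianOfEntries N (c • h) = (c : ℂ) • hermitianOfEntries N h := by
  ext i j
  simp only [hermitianOfEntries, of_apply, Matrix.smul_apply]
  split_ifs <;> simp

/-- The action on the independent entries of the map `A ↦ U A U`, which is the conjugation by `U`
when `U` is an involution. -/
noncomputable def conjEntries (U : Matrix (Fin N) (Fin N) ℂ) :
    HermitianEntries N →ₗ[ℝ] HermitianEntries N where
  toFun h := entriesOf (U * hermitianOfEntries N h * U)
  map_add' h h' := by
    rw [hermitianOfEntries_add, Matrix.mul_add, Matrix.add_mul]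
    refine Prod.ext (funext fun i => ?_) (funext fun p => ?_) <;> simp [entriesOf]
  map_smul' c h := by
    rw [hermitianOfEntries_smul, Matrix.mul_smul, Matrix.smul_mul]
    refine Prod.ext (funext fun i => ?_) (funext fun p => ?_) <;> simp [entriesOf]

theorem hermitianOfEntries_conjEntries {U : Matrix (Fin N) (Fin N) ℂ} (hU : U.IsHermitian)
    (h : HermitianEntries N) :
    hermitianOfEntries N (conjEntries U h) = U * hermitianOfEntries N h * U :=
  hermitianOfEntries_entriesOf
    (isHermitian_conj_of_isHermitian hU (isHermitian_hermitianOfEntries h))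

theorem conjEntries_sq {U : Matrix (Fin N) (Fin N) ℂ} (hU : U * U = 1) (hH : U.IsHermitian) :
    conjEntries U ^ 2 = 1 := by
  refine LinearMap.ext fun h => ?_
  calc conjEntries U (conjEntries U h)
      = entriesOf (U * hermitianOfEntries N (conjEntries U h) * U) := rfl
    _ = entriesOf ((U * U) * hermitianOfEntries N h * (U * U)) := by
        rw [hermitianOfEntries_conjEntries hH]; simp only [Matrix.mul_assoc]
    _ = h := by rw [hU, Matrix.one_mul, Matrix.mul_one, entriesOf_hermitianOfEntries]

theorem measurePreserving_conjEntries {U : Matrix (Fin N) (Fin N) ℂ} (hU : U * U = 1)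
    (hH : U.IsHermitian) : MeasurePreserving (conjEntries U) :=
  have : (volume : Measure (HermitianEntries N)).IsAddHaarMeasure :=
    Measure.prod.instIsAddHaarMeasure volume volume
  measurePreserving_of_pow_eq_one volume two_ne_zero (conjEntries_sq hU hH)

end Entries

section Bordering

open Matrix

/-- The pairs `i < j` in `Fin (m + 1)`, split according to whether `i = 0`. -/
def pairsSucc (m : ℕ) : Fin m ⊕ {p : Fin m × Fin m // p.1 < p.2} ≃
    {p : Fin (m + 1) × Fin (m + 1) // p.1 < p.2} where
  toFun := Sum.elim (fun j => ⟨(0, j.succ), Fin.succ_pos j⟩)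
    (fun p => ⟨(p.1.1.succ, p.1.2.succ), Fin.succ_lt_succ_iff.mpr p.2⟩)
  invFun p :=
    if h : p.1.1 = 0 then Sum.inl (p.1.2.pred (Fin.ne_zero_of_lt p.2))
    else Sum.inr ⟨(p.1.1.pred h, p.1.2.pred (Fin.ne_zero_of_lt p.2)), by simpa using p.2⟩
  left_inv x := by
    rcases x with j | p <;> simp
  right_inv p := by
    by_cases h : p.1.1 = 0
    · simp [h, Subtype.ext_iff, Prod.ext_iff]
    · simp [h]

/-- The independent entries of the Hermitian matrix with blocks `a`, `b`, `b†` and the matrix with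
entries `h`, where `x = (a, b, h)` and `b` is the first column. -/
def borderEntries {m : ℕ} (x : ℝ × (Fin m → ℂ) × HermitianEntries m) : HermitianEntries (m + 1) :=
  (Fin.cons x.1 x.2.2.1,
    fun p => Sum.elim (fun j => star (x.2.1 j)) x.2.2.2 ((pairsSucc m).symm p))

variable {m : ℕ} (x : ℝ × (Fin m → ℂ) × HermitianEntries m)

theorem borderEntries_apply_zero : hermitianOfEntries (m + 1) (borderEntries x) 0 0 = x.1 := by
  simp [hermitianOfEntries, borderEntries]

theorem borderEntries_apply_succ_zero (i : Fin m) :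
    hermitianOfEntries (m + 1) (borderEntries x) i.succ 0 = x.2.1 i := by
  have h_pair : (pairsSucc m).symm ⟨(0, i.succ), Fin.succ_pos i⟩ = Sum.inl i :=
    (Equiv.symm_apply_eq _).mpr rfl
  simp [hermitianOfEntries, borderEntries, h_pair]

theorem borderEntries_submatrix :
    (hermitianOfEntries (m + 1) (borderEntries x)).submatrix Fin.succ Fin.succ =
      hermitianOfEntries m x.2.2 := by
  have h_pair (i j : Fin m) (hij : i < j) : (pairsSucc m).symm
      ⟨(i.succ, j.succ), Fin.succ_lt_succ_iff.mpr hij⟩ = Sum.inr ⟨(i, j), hij⟩ :=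
    (Equiv.symm_apply_eq _).mpr rfl
  ext i j
  simp only [submatrix_apply, hermitianOfEntries, borderEntries, of_apply, Fin.succ_lt_succ_iff]
  split_ifs with hij hji
  · rw [h_pair _ _ hij, Sum.elim_inr]
  · rw [h_pair _ _ hji, Sum.elim_inr]
  · rfl

theorem measurePreserving_pairsSucc (m : ℕ) :
    MeasurePreserving fun (x : (Fin m → ℂ) × ({p : Fin m × Fin m // p.1 < p.2} → ℂ)) p =>
      Sum.elim (fun j => star (x.1 j)) x.2 ((pairsSucc m).symm p) := by
  have h_star : MeasurePreserving fun (b : Fin m → ℂ) j => star (b j) :=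
    volume_preserving_pi fun _ => Complex.conjLIE.measurePreserving
  have h_sum := volume_measurePreserving_sumPiEquivProdPi_symm
    (fun _ : Fin m ⊕ {p : Fin m × Fin m // p.1 < p.2} => ℂ)
  have h_congr := volume_measurePreserving_piCongrLeft (fun _ => ℂ) (pairsSucc m)
  convert! h_congr.comp (h_sum.comp (h_star.prod (MeasurePreserving.id volume))) using 1
  ext x p
  obtain ⟨q, rfl⟩ := (pairsSucc m).surjective p
  simp only [Equiv.symm_apply_apply, Function.comp_apply, MeasurableEquiv.coe_piCongrLeft,
    Equiv.piCongrLeft_apply_apply]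
  rcases q with j | q <;> rfl

theorem measurePreserving_borderEntries (m : ℕ) : MeasurePreserving (borderEntries (m := m)) :=
  (measurePreserving_finCons.prod (measurePreserving_pairsSucc m)).comp
    ((measurePreserving_prodAssoc volume volume volume).symm.comp
      ((MeasurePreserving.id volume).prod (measurePreserving_prodLeftComm volume volume volume)))

end Bordering

section InterlacedMeasure

open Set Polynomial

variable {n : ℕ}

theorem continuous_coeff_monicPoly (n k : ℕ) :
    Continuous fun c : Fin n → ℝ => (monicPoly c).coeff k := by
  simp only [coeff_monicPoly]
  split_ifs <;> fun_prop

theorem continuous_coeff_X_sub_C_mul_monicPoly (n k : ℕ) :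
    Continuous fun x : ℝ × (Fin n → ℝ) => ((X - C x.1) * monicPoly x.2).coeff k := by
  have h_coeff (k : ℕ) : Continuous fun x : ℝ × (Fin n → ℝ) => (monicPoly x.2).coeff k :=
    (continuous_coeff_monicPoly n k).comp continuous_snd
  simp only [sub_mul, coeff_sub, coeff_C_mul]
  refine Continuous.sub ?_ (continuous_fst.mul (h_coeff k))
  cases k with
  | zero => simpa using continuous_const
  | succ k => simpa only [coeff_X_mul] using h_coeff k

theorem continuous_euclidStep (n : ℕ) :
    Continuous fun x : ℝ × ℝ × (Fin (n + 1) → ℝ) × (Fin n → ℝ) =>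
      euclidStep x.1 x.2.1 x.2.2.1 x.2.2.2 := by
  refine continuous_pi fun i => ?_
  simp only [euclidStep, coeff_sub, coeff_C_mul]
  exact ((continuous_coeff_X_sub_C_mul_monicPoly (n + 1) i).comp
    (continuous_fst.prodMk continuous_snd.snd.fst)).sub
    (continuous_snd.fst.mul ((continuous_coeff_monicPoly n i).comp continuous_snd.snd.snd))

theorem euclidStep_eq_snoc (a r : ℝ) (q : Fin (n + 1) → ℝ) (q' : Fin n → ℝ) :
    euclidStep a r q q' = Fin.snoc (fun j : Fin (n + 1) => ((X - C a) * monicPoly q).coeff j -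
      (Fin.snoc (r • q') r : Fin (n + 1) → ℝ) j) (q (Fin.last n) - a) := by
  ext i
  refine Fin.lastCases ?_ (fun j => ?_) i
  · have h_above : (monicPoly q').coeff (n + 1) = 0 :=
      coeff_eq_zero_of_natDegree_lt (by rw [(isMonicOfDegree_monicPoly q').natDegree_eq]; omega)
    have h_last := coeff_monicPoly_fin q (Fin.last n)
    rw [Fin.val_last] at h_last
    rw [Fin.snoc_last, euclidStep, Fin.val_last, coeff_sub, coeff_C_mul, h_above, sub_mul,
      coeff_sub, coeff_X_mul, coeff_C_mul, coeff_monicPoly_self, h_last]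
    ring
  · rw [Fin.snoc_castSucc, euclidStep, coeff_sub, coeff_C_mul, Fin.val_castSucc]
    congr 1
    refine Fin.lastCases ?_ (fun i => ?_) j
    · rw [Fin.snoc_last, Fin.val_last, coeff_monicPoly_self, mul_one]
    · rw [Fin.snoc_castSucc, Fin.val_castSucc, coeff_monicPoly_fin, Pi.smul_apply, smul_eq_mul]

theorem measurePreserving_euclidStep_left (q : Fin (n + 1) → ℝ) :
    MeasurePreserving (fun x : ℝ × ℝ × (Fin n → ℝ) => euclidStep x.1 x.2.1 q x.2.2)
      (volume.prod ((powMeasure n).prod volume)) volume := by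
  have h_scale := measurePreserving_smul_right (volume : Measure (Fin n → ℝ))
  rw [Module.finrank_fin_fun] at h_scale
  have h_remainder := (MeasurePreserving.id (volume : Measure ℝ)).prod
    (measurePreserving_finSnoc.comp h_scale)
  have h_reflect : MeasurePreserving
      fun x : ℝ × (Fin (n + 1) → ℝ) => (q (Fin.last n) - x.1,
        fun j : Fin (n + 1) => ((X - C x.1) * monicPoly q).coeff j - x.2 j) := by
    refine (Measure.measurePreserving_sub_left volume _).skew_product (Continuous.measurable ?_)
      (.of_forall fun a => (Measure.measurePreserving_sub_left volume
        (fun j : Fin (n + 1) => ((X - C a) * monicPoly q).coeff j)).map_eq)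
    refine continuous_pi fun j => ?_
    exact ((continuous_coeff_X_sub_C_mul_monicPoly (n + 1) j).comp
      (continuous_fst.prodMk continuous_const)).sub ((continuous_apply j).comp continuous_snd)
  simp only [euclidStep_eq_snoc]
  exact measurePreserving_finSnoc.comp (h_reflect.comp h_remainder)

theorem measurePreserving_euclidStep (n : ℕ) :
    MeasurePreserving (fun x : ℝ × ℝ × (Fin (n + 1) → ℝ) × (Fin n → ℝ) =>
        (euclidStep x.1 x.2.1 x.2.2.1 x.2.2.2, x.2.2.1))
      (volume.prod ((powMeasure n).prod volume)) volume := by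
  have h_comm := (measurePreserving_prodLeftComm (volume : Measure ℝ)
      (volume : Measure (Fin (n + 1) → ℝ)) ((powMeasure n).prod volume)).comp
    ((MeasurePreserving.id volume).prod (measurePreserving_prodLeftComm (powMeasure n)
      volume (volume : Measure (Fin n → ℝ))))
  have h_skew := (MeasurePreserving.id (volume : Measure (Fin (n + 1) → ℝ))).skew_product
    (g := fun q (x : ℝ × ℝ × (Fin n → ℝ)) => euclidStep x.1 x.2.1 q x.2.2)
    ((continuous_euclidStep n).measurable.comp (f := fun y : (Fin (n + 1) → ℝ) × ℝ × ℝ ×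
      (Fin n → ℝ) => (y.2.1, y.2.2.1, y.1, y.2.2.2)) (by fun_prop))
    (.of_forall fun q => (measurePreserving_euclidStep_left q).map_eq)
  exact Measure.measurePreserving_swap.comp (h_skew.comp h_comm)

theorem preimage_euclidStep_interlaced (n : ℕ) :
    (fun x : ℝ × ℝ × (Fin (n + 1) → ℝ) × (Fin n → ℝ) =>
        (euclidStep x.1 x.2.1 x.2.2.1 x.2.2.2, x.2.2.1)) ⁻¹'
      {x | Interlaced (n + 1) x.1 x.2} = univ ×ˢ Ioi 0 ×ˢ {x | Interlaced n x.1 x.2} := by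
  ext x
  simp [interlaced_euclidStep_iff]

theorem measurableSet_interlaced (n : ℕ) :
    MeasurableSet {x : (Fin (n + 1) → ℝ) × (Fin n → ℝ) | Interlaced n x.1 x.2} := by
  induction n with
  | zero =>
    convert MeasurableSet.univ
    exact eq_univ_of_forall fun x => Interlaced.zero x.1 x.2
  | succ n ih =>
    have h_image : {x : (Fin (n + 2) → ℝ) × (Fin (n + 1) → ℝ) | Interlaced (n + 1) x.1 x.2} =
        (fun x : ℝ × ℝ × (Fin (n + 1) → ℝ) × (Fin n → ℝ) =>
          (euclidStep x.1 x.2.1 x.2.2.1 x.2.2.2, x.2.2.1)) ''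
          univ ×ˢ Ioi 0 ×ˢ {x | Interlaced n x.1 x.2} := by
      rw [← preimage_euclidStep_interlaced, image_preimage_eq_of_subset]
      rintro ⟨p, q⟩ h
      change Interlaced (n + 1) p q at h
      cases h
      exact ⟨(_, _, q, _), rfl⟩
    rw [h_image]
    refine (MeasurableSet.univ.prod (measurableSet_Ioi.prod ih)).image_of_measurable_injOn
      (measurePreserving_euclidStep n).measurable ?_
    rintro ⟨a₁, r₁, q, q₁⟩ hr ⟨a₂, r₂, q₂, q₂'⟩ - h
    obtain ⟨h_step, rfl⟩ := Prod.mk.inj h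
    obtain ⟨rfl, rfl, rfl⟩ := euclidStep_injective (ne_of_gt hr.2.1) h_step
    rfl

/-- Lebesgue measure on the coefficient vectors of the strictly interlacing pairs of real monic
polynomials of degrees `n + 1` and `n`. -/
noncomputable def interlacedMeasure (n : ℕ) : Measure ((Fin (n + 1) → ℝ) × (Fin n → ℝ)) :=
  volume.restrict {x | Interlaced n x.1 x.2}

instance (n : ℕ) : SFinite (interlacedMeasure n) := by
  unfold interlacedMeasure; infer_instance

theorem measurePreserving_euclidStep_interlacedMeasure (n : ℕ) :
    MeasurePreserving (fun x : ℝ × ℝ × (Fin (n + 1) → ℝ) × (Fin n → ℝ) =>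
        (euclidStep x.1 x.2.1 x.2.2.1 x.2.2.2, x.2.2.1))
      (volume.prod (((powMeasure n).restrict (Ioi 0)).prod (interlacedMeasure n)))
      (interlacedMeasure (n + 1)) := by
  have h := (measurePreserving_euclidStep n).restrict_preimage (measurableSet_interlaced (n + 1))
  rwa [preimage_euclidStep_interlaced, ← Measure.prod_restrict, ← Measure.prod_restrict,
    Measure.restrict_univ] at h

end InterlacedMeasure

section SpectralPair

open Set Polynomial Matrix

variable {n : ℕ}

theorem continuous_coeff_charpoly {m : Type*} [Fintype m] [DecidableEq m] (k : ℕ) :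
    Continuous fun A : Matrix m m ℂ => A.charpoly.coeff k := by
  have h_univ (A : Matrix m m ℂ) : A.charpoly.coeff k =
      MvPolynomial.eval (fun p : m × m => A p.1 p.2) ((Matrix.charpoly.univ ℂ m).coeff k) :=
    (Matrix.charpoly.univ_coeff_eval₂Hom m (RingHom.id ℂ) (fun p : m × m => A p.1 p.2) k).symm
  simp only [h_univ]
  exact (MvPolynomial.continuous_eval _).comp (by fun_prop)

/-- The coefficient vectors of the two monic polynomials whose quotient is the reciprocal of the
resolvent entry `b† (X - A)⁻¹ b / b† b`. -/
noncomputable def spectralPair (A : Matrix (Fin (n + 1)) (Fin (n + 1)) ℂ) (b : Fin (n + 1) → ℂ) :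
    (Fin (n + 1) → ℝ) × (Fin n → ℝ) :=
  (charCoeffs A, resolventCoeffs A b)

theorem measurable_spectralPair (n : ℕ) :
    Measurable fun x : (Fin (n + 1) → ℂ) × HermitianEntries (n + 1) =>
      spectralPair (hermitianOfEntries _ x.2) x.1 := by
  have h_matrix := (continuous_hermitianOfEntries (n + 1)).comp
    (continuous_snd (X := Fin (n + 1) → ℂ))
  have h_sqLength := (continuous_sqLength (n + 1)).comp
    (continuous_fst (Y := HermitianEntries (n + 1)))
  have h_perturbed : Continuous fun x : (Fin (n + 1) → ℂ) × HermitianEntries (n + 1) =>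
      hermitianOfEntries _ x.2 + vecMulVec x.1 (star x.1) :=
    h_matrix.add (continuous_fst.matrix_vecMulVec continuous_fst.star)
  refine Measurable.prodMk (measurable_pi_lambda _ fun i => ?_) (measurable_pi_lambda _ fun i => ?_)
  · exact (Complex.continuous_re.comp ((continuous_coeff_charpoly i).comp h_matrix)).measurable
  · refine Measurable.div (Complex.continuous_re.comp ?_).measurable h_sqLength.measurable
    simp only [resolventPoly, coeff_sub]
    exact ((continuous_coeff_charpoly i).comp h_matrix).sub
      ((continuous_coeff_charpoly i).comp h_perturbed)

theorem measurable_spectralPair_right (b : Fin (n + 1) → ℂ) :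
    Measurable fun h => spectralPair (hermitianOfEntries (n + 1) h) b :=
  Measurable.of_uncurry_left (f := fun b h => spectralPair (hermitianOfEntries (n + 1) h) b)
    (measurable_spectralPair n)

theorem spectralPair_borderEntries {x : ℝ × (Fin (n + 1) → ℂ) × HermitianEntries (n + 1)}
    (hb : x.2.1 ≠ 0) :
    spectralPair (hermitianOfEntries (n + 2) (borderEntries x)) (Pi.single 0 1) =
      (euclidStep x.1 (sqLength x.2.1) (charCoeffs (hermitianOfEntries _ x.2.2))
        (resolventCoeffs (hermitianOfEntries _ x.2.2) x.2.1),
        charCoeffs (hermitianOfEntries _ x.2.2)) := by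
  have h_column : (fun i : Fin (n + 1) => hermitianOfEntries (n + 2) (borderEntries x) i.succ 0) =
      x.2.1 := _root_.funext (borderEntries_apply_succ_zero x)
  rw [spectralPair, charCoeffs_eq_euclidStep (isHermitian_hermitianOfEntries _) (h_column ▸ hb),
    resolventCoeffs_single, h_column, borderEntries_submatrix, borderEntries_apply_zero,
    Complex.ofReal_re]

theorem measurePreserving_spectralPair_of_single
    {ν : Measure ((Fin (n + 1) → ℝ) × (Fin n → ℝ))}
    (h : MeasurePreserving (fun h => spectralPair (hermitianOfEntries (n + 1) h) (Pi.single 0 1))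
      volume ν) {v : Fin (n + 1) → ℂ} (hv : v ≠ 0) :
    MeasurePreserving (fun h => spectralPair (hermitianOfEntries (n + 1) h) v) volume ν := by
  obtain ⟨U, c, hU, hH, hc, rfl⟩ := exists_involution_mulVec_single hv
  have h_pair (x : HermitianEntries (n + 1)) :
      spectralPair (hermitianOfEntries (n + 1) x) (U *ᵥ (c • Pi.single 0 1)) =
        spectralPair (hermitianOfEntries (n + 1) (conjEntries U x)) (Pi.single 0 1) := by
    have h_conj : hermitianOfEntries _ x = U * hermitianOfEntries _ (conjEntries U x) * U := by
      rw [hermitianOfEntries_conjEntries hH, ← Matrix.mul_assoc, ← Matrix.mul_assoc, hU,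
        Matrix.one_mul, Matrix.mul_assoc, hU, Matrix.mul_one]
    rw [spectralPair, h_conj, charCoeffs_conj_involution hU,
      resolventCoeffs_conj_involution hU hH, resolventCoeffs_smul _ hc, spectralPair]
  simp only [h_pair]
  exact h.comp (measurePreserving_conjEntries hU hH)

theorem measurePreserving_spectralPair_zero (v : Fin 1 → ℂ) :
    MeasurePreserving (fun h => spectralPair (hermitianOfEntries 1 h) v) volume
      (interlacedMeasure 0) := by
  have h_univ : {x : (Fin 1 → ℝ) × (Fin 0 → ℝ) | Interlaced 0 x.1 x.2} = univ :=
    eq_univ_of_forall fun x => Interlaced.zero x.1 x.2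
  have : IsEmpty {p : Fin 1 × Fin 1 // p.1 < p.2} :=
    ⟨fun p => p.2.ne (Subsingleton.elim _ _)⟩
  have h_empty : MeasurePreserving
      fun _ : {p : Fin 1 × Fin 1 // p.1 < p.2} → ℂ => (isEmptyElim : Fin 0 → ℝ) := by
    refine ⟨measurable_const, ?_⟩
    rw [Measure.volume_pi_eq_dirac, Measure.volume_pi_eq_dirac,
      Measure.map_dirac' measurable_const]
  rw [interlacedMeasure, h_univ, Measure.restrict_univ]
  have h_pair (x : HermitianEntries 1) :
      spectralPair (hermitianOfEntries 1 x) v = (-x.1, isEmptyElim) := by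
    refine Prod.ext (_root_.funext fun i => ?_) (Subsingleton.elim _ _)
    simp [spectralPair, charCoeffs, charpoly, charmatrix, hermitianOfEntries, Fin.fin_one_eq_zero i]
  simp only [h_pair]
  exact (Measure.measurePreserving_neg (volume : Measure (Fin 1 → ℝ))).prod h_empty

theorem exists_measurePreserving_spectralPair (n : ℕ) : ∃ c : ENNReal, c ≠ 0 ∧ c ≠ ⊤ ∧
    ∀ v : Fin (n + 1) → ℂ, v ≠ 0 →
      MeasurePreserving (fun h => spectralPair (hermitianOfEntries (n + 1) h) v) volume
        (c • interlacedMeasure n) := by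
  induction n with
  | zero =>
    refine ⟨1, one_ne_zero, ENNReal.one_ne_top, fun v _ => ?_⟩
    rw [one_smul]
    exact measurePreserving_spectralPair_zero v
  | succ n ih =>
    obtain ⟨c, hc_zero, hc_top, hc⟩ := ih
    obtain ⟨κ, hκ_zero, hκ_top, hκ⟩ := exists_measurePreserving_sqLength n
    refine ⟨κ * c, mul_ne_zero hκ_zero hc_zero, ENNReal.mul_ne_top hκ_top hc_top,
      fun v hv => measurePreserving_spectralPair_of_single ?_ hv⟩
    have h_column := hκ.skew_product
      (g := fun b h => spectralPair (hermitianOfEntries (n + 1) h) b) (measurable_spectralPair n)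
      ((Measure.ae_ne volume 0).mono fun b hb => (hc b hb).map_eq)
    have h_smul : (κ • (powMeasure n).restrict (Ioi 0)).prod (c • interlacedMeasure n) =
        (κ * c) • ((powMeasure n).restrict (Ioi 0)).prod (interlacedMeasure n) := by
      rw [Measure.prod_smul_left, Measure.prod_smul_right, smul_smul]
    have h_bordered := (MeasurePreserving.id (volume : Measure ℝ)).prod (h_smul ▸ h_column)
    rw [Measure.prod_smul_right] at h_bordered
    have h_step := ((measurePreserving_euclidStep_interlacedMeasure n).smul_measure (κ * c)).comp
      h_bordered
    have h_border := measurePreserving_borderEntries (n + 1)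
    have h_ne : ∀ᵐ x : ℝ × (Fin (n + 1) → ℂ) × HermitianEntries (n + 1), x.2.1 ≠ 0 :=
      ((Measure.quasiMeasurePreserving_fst (μ := (volume : Measure (Fin (n + 1) → ℂ)))
        (ν := (volume : Measure (HermitianEntries (n + 1))))).comp
        Measure.quasiMeasurePreserving_snd).ae (Measure.ae_ne volume 0)
    rw [← h_border.map_eq]
    refine (h_step.congr ?_ ?_).map_of_comp (measurable_spectralPair_right _) h_border.measurable
    · exact (measurable_spectralPair_right _).comp h_border.measurable
    · filter_upwards [h_ne] with x hx using (spectralPair_borderEntries hx).symm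

end SpectralPair

section RootCoeffs

open Polynomial Lagrange

variable {m : ℕ}

theorem exists_perm_of_map_univ_eq {ι β : Type*} [Fintype ι] {z w : ι → β}
    (h : Finset.univ.val.map z = Finset.univ.val.map w) : ∃ σ : Equiv.Perm ι, z = w ∘ σ := by
  classical
  have h_card (c : β) : Fintype.card {i // z i = c} = Fintype.card {i // w i = c} := by
    have h_count := congrArg (Multiset.count c) h
    simp only [Multiset.count_map] at h_count
    simpa only [Fintype.card_subtype, Finset.card_def, Finset.filter_val, eq_comm] using h_count
  let σ := Equiv.ofFiberEquiv fun c => Fintype.equivOfCardEq (h_card c)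
  exact ⟨σ, _root_.funext fun i => (Equiv.ofFiberEquiv_map _ i).symm⟩

theorem roots_nodal_univ {ι R : Type*} [Fintype ι] [CommRing R] [IsDomain R] (z : ι → R) :
    (nodal Finset.univ z).roots = Finset.univ.val.map z := by
  have h := roots_multiset_prod_X_sub_C (Finset.univ.val.map z)
  rwa [Multiset.map_map] at h

theorem nodal_univ_comp_perm {ι R : Type*} [Fintype ι] [CommRing R] (z : ι → R)
    (σ : Equiv.Perm ι) : nodal Finset.univ (z ∘ σ) = nodal Finset.univ z :=
  Equiv.prod_comp σ fun l => X - C (z l)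

theorem nodal_univ_eq_of_roots_eq {ι k : Type*} [Fintype ι] [Field k] [IsAlgClosed k] {P : k[X]}
    (hP : P.Monic) {z : ι → k} (hz : P.roots = Finset.univ.val.map z) :
    nodal Finset.univ z = P := by
  rw [(IsAlgClosed.splits P).eq_prod_roots_of_monic hP, hz, Multiset.map_map]
  rfl

/-- The coefficients of the monic polynomial with the given roots, apart from the leading one. -/
noncomputable def rootCoeffs (z : Fin m → ℂ) : Fin m → ℂ := fun i => (nodal Finset.univ z).coeff i

theorem monicPoly_rootCoeffs (z : Fin m → ℂ) : monicPoly (rootCoeffs z) = nodal Finset.univ z :=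
  monicPoly_coeff ⟨by rw [natDegree_nodal, Finset.card_univ, Fintype.card_fin], nodal_monic⟩

theorem rootCoeffs_comp_perm (z : Fin m → ℂ) (σ : Equiv.Perm (Fin m)) :
    rootCoeffs (z ∘ σ) = rootCoeffs z := by
  ext i
  rw [rootCoeffs, nodal_univ_comp_perm, rootCoeffs]

theorem exists_perm_of_rootCoeffs_eq {z w : Fin m → ℂ} (h : rootCoeffs z = rootCoeffs w) :
    ∃ σ : Equiv.Perm (Fin m), z = w ∘ σ := by
  refine exists_perm_of_map_univ_eq ?_
  rw [← roots_nodal_univ, ← roots_nodal_univ, ← monicPoly_rootCoeffs, h, monicPoly_rootCoeffs]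

theorem rootCoeffs_surjective (m : ℕ) :
    Function.Surjective (rootCoeffs : (Fin m → ℂ) → Fin m → ℂ) := by
  intro c
  obtain ⟨h_degree, h_monic⟩ := isMonicOfDegree_monicPoly c
  have h_card : (monicPoly c).roots.toList.length = m := by
    rw [Multiset.length_toList, ← (IsAlgClosed.splits _).natDegree_eq_card_roots, h_degree]
  obtain ⟨z, hz⟩ : ∃ z : Fin m → ℂ, List.ofFn z = (monicPoly c).roots.toList :=
    ⟨fun i => (monicPoly c).roots.toList.get (i.cast h_card.symm), List.ext_get (by simp [h_card])
      (by simp)⟩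
  refine ⟨z, monicPoly_injective ?_⟩
  rw [monicPoly_rootCoeffs, nodal_univ_eq_of_roots_eq h_monic]
  rw [Fin.univ_val_map, hz, Multiset.coe_toList]

theorem rootCoeffs_last {n : ℕ} (z : Fin (n + 1) → ℂ) :
    rootCoeffs z (Fin.last n) = -∑ l, z l := by
  have h := prod_X_sub_C_coeff_card_pred Finset.univ z (by simp)
  rwa [Finset.card_univ, Fintype.card_fin, Nat.add_sub_cancel] at h

theorem differentiable_coeff_nodal {ι E : Type*} [NormedAddCommGroup E] [NormedSpace ℂ E]
    (s : Finset ι) {f : E → ι → ℂ} (hf : ∀ l, Differentiable ℂ fun x => f x l) (k : ℕ) :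
    Differentiable ℂ fun x => (nodal s (f x)).coeff k := by
  classical
  induction s using Finset.induction_on generalizing k with
  | empty => simp
  | insert a s ha ih =>
    simp only [nodal_insert_eq_nodal ha, sub_mul, coeff_sub, coeff_C_mul]
    refine Differentiable.sub ?_ ((hf a).mul (ih k))
    cases k with
    | zero => simp
    | succ k => simpa only [coeff_X_mul] using ih k

theorem measurable_rootCoeffs (m : ℕ) : Measurable (rootCoeffs : (Fin m → ℂ) → Fin m → ℂ) :=
  measurable_pi_lambda _ fun i =>
    (differentiable_coeff_nodal Finset.univ (fun l => by fun_prop) i).continuous.measurable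

end RootCoeffs

section Ordered

variable {m : ℕ}

/-- Tuples strictly increasing for a Borel linear order on `ℂ`, namely the one induced by a
measurable embedding into `ℝ`. They form a fundamental domain for the permutations of tuples with
distinct entries. -/
def Ordered (z : Fin m → ℂ) : Prop := StrictMono (embeddingReal ℂ ∘ z)

theorem measurableSet_ordered (m : ℕ) : MeasurableSet {z : Fin m → ℂ | Ordered z} := by
  simp only [Ordered, StrictMono, Set.ofPred_forall]
  refine .iInter fun i => .iInter fun j => .iInter fun _ => ?_
  exact measurableSet_lt (by simp only [Function.comp]; fun_prop)
    (by simp only [Function.comp]; fun_prop)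

theorem exists_perm_ordered {z : Fin m → ℂ} (h : Function.Injective z) :
    ∃ σ : Equiv.Perm (Fin m), Ordered (z ∘ σ) :=
  ⟨Tuple.sort (embeddingReal ℂ ∘ z), (Tuple.monotone_sort _).strictMono_of_injective
    (((measurableEmbedding_embeddingReal ℂ).injective.comp h).comp (Equiv.injective _))⟩

theorem Ordered.injective {z : Fin m → ℂ} (h : Ordered z) : Function.Injective z :=
  StrictMono.injective h |>.of_comp

theorem Ordered.comp_perm_eq {z : Fin m → ℂ} {σ τ : Equiv.Perm (Fin m)} (hσ : Ordered (z ∘ σ))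
    (hτ : Ordered (z ∘ τ)) : z ∘ σ = z ∘ τ :=
  (measurableEmbedding_embeddingReal ℂ).injective.comp_left
    (Tuple.unique_monotone (f := embeddingReal ℂ ∘ z) hσ.monotone hτ.monotone)

theorem Ordered.perm_eq {z : Fin m → ℂ} {σ τ : Equiv.Perm (Fin m)} (hσ : Ordered (z ∘ σ))
    (hτ : Ordered (z ∘ τ)) : σ = τ := by
  have hz : Function.Injective z := (Equiv.injective_comp σ z).mp hσ.injective
  exact Equiv.coe_fn_injective (hz.comp_left (hσ.comp_perm_eq hτ))

theorem Ordered.eq_of_rootCoeffs_eq {z w : Fin m → ℂ} {τ : Equiv.Perm (Fin m)}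
    (hz : Ordered (z ∘ τ)) (hw : Ordered (w ∘ τ)) (h : rootCoeffs z = rootCoeffs w) : z = w := by
  obtain ⟨ρ, rfl⟩ := exists_perm_of_rootCoeffs_eq h
  exact τ.surjective.injective_comp_right (Ordered.comp_perm_eq (σ := τ.trans ρ) hz hw)

end Ordered

section LowerCoeffs

open Polynomial Lagrange Matrix

variable {n : ℕ}

/-- The tuple with sum `s` whose entries of nonzero index are given by `w`. -/
def tupleWithSum {G : Type*} [AddCommGroup G] (s : G) (w : Fin n → G) : Fin (n + 1) → G :=
  Fin.cons (s - ∑ k, w k) w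

@[simp] theorem tupleWithSum_zero {G : Type*} [AddCommGroup G] (s : G) (w : Fin n → G) :
    tupleWithSum s w 0 = s - ∑ k, w k := rfl

@[simp] theorem tupleWithSum_succ {G : Type*} [AddCommGroup G] (s : G) (w : Fin n → G)
    (k : Fin n) : tupleWithSum s w k.succ = w k := rfl

theorem sum_tupleWithSum {G : Type*} [AddCommGroup G] (s : G) (w : Fin n → G) :
    ∑ l, tupleWithSum s w l = s := by
  simp [Fin.sum_univ_succ]

theorem tupleWithSum_sum {G : Type*} [AddCommGroup G] (z : Fin (n + 1) → G) :
    tupleWithSum (∑ l, z l) (Fin.tail z) = z := by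
  ext l
  cases l using Fin.cases <;> simp [Fin.sum_univ_succ, Fin.tail]

theorem differentiable_tupleWithSum (n : ℕ) (l : Fin (n + 1)) :
    Differentiable ℂ fun p : ℂ × (Fin n → ℂ) => tupleWithSum p.1 p.2 l := by
  cases l using Fin.cases <;> simp only [tupleWithSum_zero, tupleWithSum_succ] <;> fun_prop

/-- The coefficients, apart from the two leading ones, of the monic polynomial whose roots have the
sum `s` and are given by `w` from the second one on. -/
noncomputable def lowerCoeffs (s : ℂ) (w : Fin n → ℂ) : Fin n → ℂ :=
  Fin.init (rootCoeffs (tupleWithSum s w))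

theorem rootCoeffs_tupleWithSum (s : ℂ) (w : Fin n → ℂ) :
    rootCoeffs (tupleWithSum s w) = Fin.snoc (lowerCoeffs s w) (-s) := by
  rw [lowerCoeffs, ← sum_tupleWithSum s w, ← rootCoeffs_last, sum_tupleWithSum, Fin.snoc_init_self]

theorem lowerCoeffs_tail {s : ℂ} {c : Fin n → ℂ} {z : Fin (n + 1) → ℂ}
    (hz : rootCoeffs z = Fin.snoc c (-s)) :
    tupleWithSum s (Fin.tail z) = z ∧ lowerCoeffs s (Fin.tail z) = c := by
  have h_sum : ∑ l, z l = s := by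
    rw [← neg_inj, ← rootCoeffs_last, hz, Fin.snoc_last]
  subst h_sum
  rw [lowerCoeffs, tupleWithSum_sum, hz, Fin.init_snoc]
  exact ⟨rfl, rfl⟩

theorem differentiable_lowerCoeffs_uncurry (n : ℕ) :
    Differentiable ℂ fun p : ℂ × (Fin n → ℂ) => lowerCoeffs p.1 p.2 :=
  differentiable_pi.mpr fun i =>
    differentiable_coeff_nodal Finset.univ (differentiable_tupleWithSum n) i

theorem differentiable_lowerCoeffs (s : ℂ) :
    Differentiable ℂ (lowerCoeffs s : (Fin n → ℂ) → Fin n → ℂ) :=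
  (differentiable_lowerCoeffs_uncurry n).comp (f := Prod.mk s) (by fun_prop)

theorem nodal_tupleWithSum (s : ℂ) (w : Fin n → ℂ) (k : Fin n) :
    nodal Finset.univ (tupleWithSum s w) =
      (X - C (s - ∑ j, w j)) * ((X - C (w k)) * nodal (Finset.univ.erase k) w) := by
  rw [← nodal_eq_mul_nodal_erase (Finset.mem_univ k), nodal_eq, nodal_eq, Fin.prod_univ_succ]
  rfl

theorem nodal_tupleWithSum_add_single (s : ℂ) (w : Fin n → ℂ) (k : Fin n) (t : ℂ) :
    nodal Finset.univ (tupleWithSum s (w + Pi.single k t)) =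
      nodal Finset.univ (tupleWithSum s w) +
        C (t * (s - ∑ j, w j - w k) - t ^ 2) * nodal (Finset.univ.erase k) w := by
  have h_erase : nodal (Finset.univ.erase k) (w + Pi.single k t) =
      nodal (Finset.univ.erase k) w :=
    Finset.prod_congr rfl fun l hl => by simp [Finset.ne_of_mem_erase hl]
  rw [nodal_tupleWithSum s _ k, nodal_tupleWithSum s w k, h_erase]
  simp only [Pi.add_apply, Pi.single_eq_same, Finset.sum_add_distrib, Finset.sum_pi_single',
    Finset.mem_univ, if_true, C_sub, C_add, C_mul, C_pow]
  ring

theorem fderiv_lowerCoeffs_single (s : ℂ) (w : Fin n → ℂ) (i k : Fin n) :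
    fderiv ℂ (lowerCoeffs s) w (Pi.single k 1) i =
      (s - ∑ j, w j - w k) * (nodal (Finset.univ.erase k) w).coeff i := by
  have h_line : HasDerivAt (fun t : ℂ => lowerCoeffs s (w + t • Pi.single k 1) i)
      (fderiv ℂ (lowerCoeffs s) w (Pi.single k 1) i) 0 :=
    hasDerivAt_pi.mp
      ((differentiable_lowerCoeffs s w).hasFDerivAt.hasLineDerivAt (Pi.single k (1 : ℂ))) i
  have h_eq (t : ℂ) : lowerCoeffs s (w + t • Pi.single k 1) i = lowerCoeffs s w i +
      (t * (s - ∑ j, w j - w k) - t ^ 2) * (nodal (Finset.univ.erase k) w).coeff i := by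
    rw [← Pi.single_smul, smul_eq_mul, mul_one]
    simp only [lowerCoeffs, Fin.init, rootCoeffs, nodal_tupleWithSum_add_single, coeff_add,
      coeff_C_mul, Fin.val_castSucc]
  simp only [h_eq] at h_line
  refine h_line.unique ?_
  simpa using ((((hasDerivAt_id (0 : ℂ)).mul_const (s - ∑ j, w j - w k)).sub
    (hasDerivAt_pow 2 (0 : ℂ))).mul_const
      ((nodal (Finset.univ.erase k) w).coeff i)).const_add (lowerCoeffs s w i)

theorem eval_nodal_erase (w : Fin n → ℂ) (j k : Fin n) :
    (nodal (Finset.univ.erase k) w).eval (w j) =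
      diagonal (fun k => ∏ l ∈ Finset.univ.erase k, (w k - w l)) j k := by
  rcases eq_or_ne j k with rfl | hjk
  · rw [eval_nodal, diagonal_apply_eq]
  · rw [eval_nodal_at_node (Finset.mem_erase.mpr ⟨hjk, Finset.mem_univ j⟩), diagonal_apply_ne _ hjk]

theorem vandermonde_mul_coeff_nodal_erase (w : Fin n → ℂ) :
    vandermonde w * of (fun i k : Fin n => (nodal (Finset.univ.erase k) w).coeff i) =
      diagonal fun k => ∏ l ∈ Finset.univ.erase k, (w k - w l) := by
  ext j k
  have h_degree : (nodal (Finset.univ.erase k) w).natDegree < n := by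
    have hn := k.pos
    rw [natDegree_nodal, Finset.card_erase_of_mem (Finset.mem_univ k), Finset.card_univ,
      Fintype.card_fin]
    omega
  rw [← eval_nodal_erase, eval_eq_sum_range' h_degree, ← Fin.sum_univ_eq_sum_range
    (fun i => (nodal (Finset.univ.erase k) w).coeff i * w j ^ i), mul_apply]
  simp only [vandermonde_apply, of_apply, mul_comm]

theorem norm_prod_erase_sub (w : Fin n → ℂ) :
    ‖∏ k, ∏ l ∈ Finset.univ.erase k, (w k - w l)‖ = ‖(vandermonde w).det‖ ^ 2 := by
  have h_split (k : Fin n) : Finset.univ.erase k = Finset.Iio k ∪ Finset.Ioi k := by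
    ext l; simp [lt_or_lt_iff_ne]
  have h_disjoint (k : Fin n) : Disjoint (Finset.Iio k) (Finset.Ioi k) :=
    Finset.disjoint_left.mpr fun l h₁ h₂ => (Finset.mem_Iio.mp h₁).asymm (Finset.mem_Ioi.mp h₂)
  simp only [h_split, Finset.prod_union (h_disjoint _), Finset.prod_mul_distrib, norm_mul,
    norm_prod, det_vandermonde, pow_two]
  congr 1
  · rw [Finset.prod_comm' (t' := Finset.univ) (s' := fun k => Finset.Ioi k) (by simp)]
  · exact Finset.prod_congr rfl fun k _ => Finset.prod_congr rfl fun l _ => norm_sub_rev _ _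

theorem norm_det_coeff_nodal_erase (w : Fin n → ℂ) :
    ‖(of fun i k : Fin n => (nodal (Finset.univ.erase k) w).coeff i).det‖ =
      ‖(vandermonde w).det‖ := by
  by_cases hw : Function.Injective w
  · have h := congrArg (fun M => ‖M.det‖) (vandermonde_mul_coeff_nodal_erase w)
    simp only [det_mul, det_diagonal, norm_mul, norm_prod_erase_sub, pow_two] at h
    exact mul_left_cancel₀ (norm_ne_zero_iff.mpr (det_vandermonde_ne_zero_iff.mpr hw)) h
  · rw [not_ne_iff.mp (mt det_vandermonde_ne_zero_iff.mp hw)]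
    simp only [Function.Injective, not_forall] at hw
    obtain ⟨j, k, hjk, hne⟩ := hw
    have h_column : nodal (Finset.univ.erase j) w = nodal (Finset.univ.erase k) w := by
      refine mul_left_cancel₀ (X_sub_C_ne_zero (w j)) ?_
      rw [← nodal_eq_mul_nodal_erase (Finset.mem_univ j), hjk,
        ← nodal_eq_mul_nodal_erase (Finset.mem_univ k)]
    rw [det_zero_of_column_eq hne fun i => by rw [of_apply, of_apply, h_column]]

theorem norm_det_vandermonde_tupleWithSum (s : ℂ) (w : Fin n → ℂ) :
    ‖(vandermonde (tupleWithSum s w)).det‖ =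
      ‖∏ k, (s - ∑ j, w j - w k)‖ * ‖(vandermonde w).det‖ := by
  rw [det_vandermonde, Fin.prod_univ_succ, Fin.prod_Ioi_zero, norm_mul, det_vandermonde]
  simp only [Fin.prod_Ioi_succ, tupleWithSum_zero, tupleWithSum_succ, norm_prod]
  congr 1
  exact Finset.prod_congr rfl fun k _ => norm_sub_rev _ _

theorem norm_det_fderiv_lowerCoeffs (s : ℂ) (w : Fin n → ℂ) :
    ‖(fderiv ℂ (lowerCoeffs s) w).det‖ = ‖(vandermonde (tupleWithSum s w)).det‖ := by
  have h_matrix : LinearMap.toMatrix' (fderiv ℂ (lowerCoeffs s) w : (Fin n → ℂ) →ₗ[ℂ] Fin n → ℂ) =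
      of fun i k => (s - ∑ j, w j - w k) *
        (of fun i k : Fin n => (nodal (Finset.univ.erase k) w).coeff i) i k := by
    ext i k
    rw [LinearMap.toMatrix'_apply]
    exact fderiv_lowerCoeffs_single s w i k
  rw [ContinuousLinearMap.det, ← LinearMap.det_toMatrix', h_matrix, det_mul_row, norm_mul,
    norm_det_coeff_nodal_erase, norm_det_vandermonde_tupleWithSum]

end LowerCoeffs

section ChangeOfVariables

open Set
open scoped ENNReal Nat Function

theorem map_withDensity_abs_det_fderiv_of_iUnion {E ι : Type*} [NormedAddCommGroup E]
    [NormedSpace ℝ E] [FiniteDimensional ℝ E] [MeasurableSpace E] [BorelSpace E] (μ : Measure E)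
    [μ.IsAddHaarMeasure] [Fintype ι] {f : E → E} {f' : E → E →L[ℝ] E} {D : ι → Set E}
    (hf' : ∀ x, HasFDerivAt f (f' x) x) (hD : ∀ i, MeasurableSet (D i))
    (h_disjoint : Pairwise (Disjoint on D)) (h_inj : ∀ i, InjOn f (D i))
    (h_union : ∀ x ∉ ⋃ i, D i, (f' x).det = 0)
    (h_image : ∀ i, (f '' D i)ᶜ ⊆ f '' {x | (f' x).det = 0}) :
    (μ.withDensity fun x => ENNReal.ofReal |(f' x).det|).map f = Fintype.card ι • μ := by
  have h_full (i : ι) : μ.restrict (f '' D i) = μ := by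
    refine Measure.restrict_eq_self_of_ae_mem (mem_ae_iff.mpr (measure_mono_null (h_image i) ?_))
    exact addHaar_image_eq_zero_of_det_fderivWithin_eq_zero μ
      (fun x _ => (hf' x).hasFDerivWithinAt) fun x hx => hx
  have h_support : (⋃ i, D i).indicator (fun x => ENNReal.ofReal |(f' x).det|) =
      fun x => ENNReal.ofReal |(f' x).det| :=
    indicator_eq_self.mpr fun x hx => by
      contrapose! hx
      rw [Function.notMem_support, h_union x hx, abs_zero, ENNReal.ofReal_zero]
  have hf : Measurable f :=
    (continuous_iff_continuousAt.mpr fun x => (hf' x).continuousAt).measurable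
  rw [← h_support, withDensity_indicator (.iUnion hD), Measure.restrict_iUnion h_disjoint hD,
    withDensity_sum, Measure.map_sum hf.aemeasurable]
  simp only [map_withDensity_abs_det_fderiv_eq_addHaar μ (hD _).nullMeasurableSet
    (fun x _ => (hf' x).hasFDerivWithinAt) (h_inj _), h_full]
  rw [Measure.sum_fintype, Finset.sum_const, Finset.card_univ]

theorem abs_det_restrictScalars {E : Type*} [NormedAddCommGroup E] [NormedSpace ℂ E]
    (L : E →L[ℂ] E) : |(L.restrictScalars ℝ).det| = ‖L.det‖ ^ 2 := by
  rw [← abs_of_nonneg (sq_nonneg ‖L.det‖), ← Complex.normSq_eq_norm_sq,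
    ← Algebra.norm_complex_apply]
  exact congrArg _ LinearMap.det_restrictScalars

variable {n : ℕ}

/-- The squared modulus `∏_{j < k} |z_k - z_j|²` of the Vandermonde determinant. -/
noncomputable def vandermondeSq {m : ℕ} (z : Fin m → ℂ) : ℝ≥0∞ :=
  ENNReal.ofReal (‖(Matrix.vandermonde z).det‖ ^ 2)

theorem measurable_vandermondeSq (m : ℕ) :
    Measurable (vandermondeSq : (Fin m → ℂ) → ℝ≥0∞) := by
  have h_cont : Continuous fun z : Fin m → ℂ => Matrix.vandermonde z :=
    continuous_matrix fun i j => by simp only [Matrix.vandermonde_apply]; fun_prop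
  exact (h_cont.matrix_det.norm.pow 2).measurable.ennreal_ofReal

theorem compl_image_lowerCoeffs_subset (s : ℂ) (τ : Equiv.Perm (Fin (n + 1))) :
    (lowerCoeffs s '' {w | Ordered (tupleWithSum s w ∘ τ)})ᶜ ⊆
      lowerCoeffs s '' {w | (Matrix.vandermonde (tupleWithSum s w)).det = 0} := by
  intro c hc
  obtain ⟨z, hz⟩ := rootCoeffs_surjective (n + 1) (Fin.snoc c (-s))
  by_cases h_inj : Function.Injective z
  · obtain ⟨σ, hσ⟩ := exists_perm_ordered h_inj
    have h_tail := lowerCoeffs_tail ((rootCoeffs_comp_perm z (τ⁻¹.trans σ)).trans hz)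
    refine absurd ⟨_, ?_, h_tail.2⟩ hc
    rw [mem_ofPred_eq, h_tail.1]
    convert hσ using 1
    ext i
    simp
  · refine ⟨_, ?_, (lowerCoeffs_tail hz).2⟩
    rw [mem_ofPred_eq, (lowerCoeffs_tail hz).1]
    exact not_ne_iff.mp (mt Matrix.det_vandermonde_ne_zero_iff.mp h_inj)

theorem injOn_lowerCoeffs (s : ℂ) (τ : Equiv.Perm (Fin (n + 1))) :
    InjOn (lowerCoeffs s) {w | Ordered (tupleWithSum s w ∘ τ)} := by
  intro w hw w' hw' h
  have h_tuple : tupleWithSum s w = tupleWithSum s w' := by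
    refine Ordered.eq_of_rootCoeffs_eq hw hw' ?_
    rw [rootCoeffs_tupleWithSum, rootCoeffs_tupleWithSum, h]
  exact (Fin.cons_injective2 h_tuple).2

theorem measurePreserving_lowerCoeffs (s : ℂ) :
    MeasurePreserving (lowerCoeffs s)
      (volume.withDensity fun w : Fin n → ℂ => vandermondeSq (tupleWithSum s w))
      (((n + 1)! : ℝ≥0∞) • volume) := by
  have h_det (w : Fin n → ℂ) : |((fderiv ℂ (lowerCoeffs s) w).restrictScalars ℝ).det| =
      ‖(Matrix.vandermonde (tupleWithSum s w)).det‖ ^ 2 := by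
    rw [abs_det_restrictScalars, norm_det_fderiv_lowerCoeffs]
  have h_det_zero (w : Fin n → ℂ) : ((fderiv ℂ (lowerCoeffs s) w).restrictScalars ℝ).det = 0 ↔
      (Matrix.vandermonde (tupleWithSum s w)).det = 0 := by
    rw [← abs_eq_zero, h_det, sq_eq_zero_iff, norm_eq_zero]
  have h_cont (τ : Equiv.Perm (Fin (n + 1))) : Continuous fun w => tupleWithSum s w ∘ τ :=
    continuous_pi fun i => ((differentiable_tupleWithSum n (τ i)).comp
      (f := Prod.mk s) (by fun_prop)).continuous
  refine ⟨(differentiable_lowerCoeffs s).continuous.measurable, ?_⟩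
  have h_map := map_withDensity_abs_det_fderiv_of_iUnion volume
    (D := fun τ : Equiv.Perm (Fin (n + 1)) => {w | Ordered (tupleWithSum s w ∘ τ)})
    (fun w => (differentiable_lowerCoeffs s w).hasFDerivAt.restrictScalars ℝ)
    (fun τ => (h_cont τ).measurable (measurableSet_ordered _))
    (fun σ τ hne => Set.disjoint_left.mpr fun w hσ hτ => hne (Ordered.perm_eq hσ hτ))
    (injOn_lowerCoeffs s) (fun w hw => (h_det_zero w).mpr ?_)
    (fun τ => by simpa only [h_det_zero] using compl_image_lowerCoeffs_subset s τ)
  · rw [Fintype.card_perm, Fintype.card_fin, ← Nat.cast_smul_eq_nsmul ℝ≥0∞] at h_map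
    simpa only [vandermondeSq, h_det] using h_map
  · contrapose! hw
    obtain ⟨τ, hτ⟩ := exists_perm_ordered (Matrix.det_vandermonde_ne_zero_iff.mp hw)
    exact mem_iUnion.mpr ⟨τ, hτ⟩

end ChangeOfVariables

section DeltaSum

variable {n N : ℕ}

theorem measurePreserving_tupleWithSum_uncurry (n : ℕ) :
    MeasurePreserving fun x : ℝ × (Fin n → ℝ) => tupleWithSum x.1 x.2 := by
  have h_shear := (MeasurePreserving.id (volume : Measure (Fin n → ℝ))).skew_product
    (g := fun y s => s - ∑ k, y k) (μc := (volume : Measure ℝ)) (by fun_prop)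
    (.of_forall fun y => (measurePreserving_sub_right volume (∑ k, y k)).map_eq)
  exact measurePreserving_finCons.comp
    (Measure.measurePreserving_swap.comp (h_shear.comp Measure.measurePreserving_swap))

theorem measurePreserving_tupleWithSum (α : ℝ) :
    MeasurePreserving (tupleWithSum α : (Fin n → ℝ) → _) volume (deltaSum (n + 1) α) := by
  let e := MeasurableEquiv.piCongrLeft (fun _ => ℝ) (finSuccAboveEquiv (0 : Fin (n + 1)))
  have h_extend : Measurable fun (y : {l : Fin (n + 1) // l ≠ 0} → ℝ) (l : Fin (n + 1)) =>
      if hl : l = 0 then α - ∑ k, y k else y ⟨l, hl⟩ := by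
    refine measurable_pi_lambda _ fun l => ?_
    split_ifs <;> fun_prop
  have h_apply (y : Fin n → ℝ) (k : Fin n) : e y ⟨k.succ, k.succ_ne_zero⟩ = y k :=
    Equiv.piCongrLeft_apply_apply (fun _ => ℝ) (finSuccAboveEquiv (0 : Fin (n + 1))) y k
  have h_comp := (h_extend.measurePreserving volume).comp (volume_measurePreserving_piCongrLeft
    (fun _ => ℝ) (finSuccAboveEquiv (0 : Fin (n + 1))))
  rw [deltaSum]
  convert h_comp using 1
  ext y l
  cases l using Fin.cases with
  | zero =>
    have h_sum : ∑ k, e y k = ∑ k, y k :=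
      ((finSuccAboveEquiv (0 : Fin (n + 1))).sum_comp (e y)).symm.trans
        (Finset.sum_congr rfl fun k _ => h_apply y k)
    rw [tupleWithSum_zero, ← h_sum]
    rfl
  | succ k =>
    rw [tupleWithSum_succ, ← h_apply y k]
    rfl

instance [NeZero N] (α : ℝ) : SFinite (deltaSum N α) := by
  unfold deltaSum; infer_instance

theorem measurePreserving_complexMk (n : ℕ) :
    MeasurePreserving fun (x : (Fin n → ℝ) × (Fin n → ℝ)) l => (⟨x.1 l, x.2 l⟩ : ℂ) :=
  (volume_preserving_pi fun _ : Fin n => Complex.volume_preserving_equiv_real_prod.symm).comp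
    (volume_measurePreserving_arrowProdEquivProdArrow ℝ ℝ (Fin n)).symm

theorem measurePreserving_complexMk_deltaSumIm [NeZero N] (α : ℝ) :
    MeasurePreserving (fun (x : (Fin N → ℝ) × (Fin N → ℝ)) l => (⟨x.1 l, x.2 l⟩ : ℂ))
      (volume.prod (deltaSum N α)) (deltaSumIm N α) :=
  (measurePreserving_complexMk N).measurable.measurePreserving _

theorem measurable_complexMk (α : ℝ) : Measurable fun s : ℝ => (⟨s, α⟩ : ℂ) :=
  Complex.measurableEquivRealProd.symm.measurable.comp (f := fun s => (s, α)) (by fun_prop)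

theorem tupleWithSum_complexMk (s α : ℝ) (x y : Fin n → ℝ) :
    tupleWithSum (⟨s, α⟩ : ℂ) (fun k => ⟨x k, y k⟩) =
      fun l => ⟨tupleWithSum s x l, tupleWithSum α y l⟩ := by
  ext l : 1
  cases l using Fin.cases
  · apply Complex.ext <;> simp
  · simp

theorem measurePreserving_tupleWithSum_deltaSumIm (α : ℝ) :
    MeasurePreserving (fun x : ℝ × (Fin n → ℂ) => tupleWithSum ⟨x.1, α⟩ x.2) volume
      (deltaSumIm (n + 1) α) := by
  have h_real := (measurePreserving_complexMk_deltaSumIm α).comp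
    (((measurePreserving_tupleWithSum_uncurry n).prod (measurePreserving_tupleWithSum α)).comp
      (measurePreserving_prodAssoc volume volume volume).symm)
  have h_mk := (MeasurePreserving.id (volume : Measure ℝ)).prod (measurePreserving_complexMk n)
  have h_meas : Measurable fun x : ℝ × (Fin n → ℂ) => tupleWithSum (⟨x.1, α⟩ : ℂ) x.2 :=
    measurable_pi_lambda _ fun l => (differentiable_tupleWithSum n l).continuous.measurable.comp
      (((measurable_complexMk α).comp measurable_fst).prodMk measurable_snd)
  rw [Measure.volume_eq_prod, ← h_mk.map_eq]
  refine MeasurePreserving.map_of_comp ?_ h_meas h_mk.measurable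
  convert h_real using 1
  · exact _root_.funext fun x => tupleWithSum_complexMk _ _ _ _
  · rfl

theorem measurable_comp_perm {β : Type*} [MeasurableSpace β] (σ : Equiv.Perm (Fin N)) :
    Measurable fun z : Fin N → β => z ∘ σ :=
  measurable_pi_lambda _ fun i => measurable_pi_apply (σ i)

theorem measurePreserving_comp_perm_volume {β : Type*} [MeasureSpace β]
    [SigmaFinite (volume : Measure β)] (σ : Equiv.Perm (Fin N)) :
    MeasurePreserving (fun x : Fin N → β => x ∘ σ) := by
  have h_comp : ⇑(MeasurableEquiv.piCongrLeft (fun _ => β) σ.symm) = fun x => x ∘ σ := by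
    ext x i
    conv_lhs => rw [← σ.symm_apply_apply i]
    exact Equiv.piCongrLeft_apply_apply (fun _ => β) σ.symm x (σ i)
  exact h_comp ▸ volume_measurePreserving_piCongrLeft (fun _ => β) σ.symm

/-- The action of a permutation on the tuples with sum `0`, in the coordinates given by the entries
of nonzero index. -/
def permSumZero (σ : Equiv.Perm (Fin (n + 1))) : (Fin n → ℝ) →ₗ[ℝ] Fin n → ℝ where
  toFun y := Fin.tail (tupleWithSum 0 y ∘ σ)
  map_add' y y' := by
    ext k
    simp only [Fin.tail, Function.comp_apply, Pi.add_apply]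
    cases σ k.succ using Fin.cases <;> simp [Finset.sum_add_distrib, add_comm]
  map_smul' c y := by
    ext k
    simp only [Fin.tail, Function.comp_apply, Pi.smul_apply, RingHom.id_apply]
    cases σ k.succ using Fin.cases <;> simp [Finset.mul_sum]

theorem tupleWithSum_tail_comp_perm {G : Type*} [AddCommGroup G] (s : G) (y : Fin n → G)
    (σ : Equiv.Perm (Fin (n + 1))) :
    tupleWithSum s (Fin.tail (tupleWithSum s y ∘ σ)) = tupleWithSum s y ∘ σ := by
  have h_sum : ∑ l, (tupleWithSum s y ∘ σ) l = s :=
    (Equiv.sum_comp σ (tupleWithSum s y)).trans (sum_tupleWithSum s y)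
  simpa only [h_sum] using tupleWithSum_sum (tupleWithSum s y ∘ σ)

theorem tupleWithSum_permSumZero_pow (σ : Equiv.Perm (Fin (n + 1))) (k : ℕ) (y : Fin n → ℝ) :
    tupleWithSum 0 ((permSumZero σ ^ k) y) = tupleWithSum 0 y ∘ (σ ^ k : Equiv.Perm _) := by
  induction k with
  | zero => rfl
  | succ k ih =>
    rw [pow_succ', Module.End.mul_apply, pow_succ, Equiv.Perm.coe_mul, ← Function.comp_assoc, ← ih]
    exact tupleWithSum_tail_comp_perm 0 _ σ

theorem permSumZero_pow_orderOf (σ : Equiv.Perm (Fin (n + 1))) :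
    permSumZero σ ^ orderOf σ = 1 := by
  refine LinearMap.ext fun y => ?_
  have h_tuple := tupleWithSum_permSumZero_pow σ (orderOf σ) y
  rw [pow_orderOf_eq_one] at h_tuple
  exact (Fin.cons_injective2 h_tuple).2

theorem tail_tupleWithSum_comp_perm (α : ℝ) (y : Fin n → ℝ) (σ : Equiv.Perm (Fin (n + 1))) :
    Fin.tail (tupleWithSum α y ∘ σ) =
      permSumZero σ y + Fin.tail ((Pi.single 0 α : Fin (n + 1) → ℝ) ∘ σ) := by
  ext k
  simp only [permSumZero, LinearMap.coe_mk, AddHom.coe_mk, Fin.tail, Function.comp_apply,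
    Pi.add_apply]
  cases σ k.succ using Fin.cases <;> simp [neg_add_eq_sub]

theorem measurePreserving_comp_perm_deltaSum [NeZero N] (α : ℝ) (σ : Equiv.Perm (Fin N)) :
    MeasurePreserving (fun y : Fin N → ℝ => y ∘ σ) (deltaSum N α) (deltaSum N α) := by
  obtain ⟨n, rfl⟩ := Nat.exists_eq_succ_of_ne_zero (NeZero.ne N)
  have h_tail : MeasurePreserving fun y : Fin n → ℝ => Fin.tail (tupleWithSum α y ∘ σ) := by
    simp only [tail_tupleWithSum_comp_perm]
    exact (measurePreserving_add_right volume _).comp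
      (measurePreserving_of_pow_eq_one volume (orderOf_pos σ).ne' (permSumZero_pow_orderOf σ))
  exact (measurePreserving_tupleWithSum α).of_semiconj h_tail
    (fun y => tupleWithSum_tail_comp_perm α y σ) (measurable_comp_perm σ)

theorem measurePreserving_comp_perm_deltaSumIm [NeZero N] (α : ℝ) (σ : Equiv.Perm (Fin N)) :
    MeasurePreserving (fun z : Fin N → ℂ => z ∘ σ) (deltaSumIm N α) (deltaSumIm N α) :=
  (measurePreserving_complexMk_deltaSumIm α).of_semiconj
    ((measurePreserving_comp_perm_volume σ).prod (measurePreserving_comp_perm_deltaSum α σ))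
    (fun _ => rfl) (measurable_comp_perm σ)

end DeltaSum

section PerturbedCoeffs

open Set Polynomial
open scoped ENNReal Nat

section WithDensity

variable {E F G : Type*} [MeasurableSpace E] [MeasurableSpace F] [MeasurableSpace G]

theorem measurePreserving_withDensity {μ : Measure E} {ν : Measure F} {f : E → F}
    (hf : MeasurePreserving f μ ν) {h : F → ℝ≥0∞} (hh : Measurable h) :
    MeasurePreserving f (μ.withDensity fun x => h (f x)) (ν.withDensity h) := by
  refine ⟨hf.measurable, Measure.ext fun s hs => ?_⟩
  rw [Measure.map_apply hf.measurable hs, withDensity_apply _ (hf.measurable hs),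
    withDensity_apply _ hs, hf.setLIntegral_comp_preimage hs hh]

theorem measurePreserving_skew_product_withDensity (μ : Measure E) {ν : Measure F} {ρ : Measure G}
    [SFinite ν] [SFinite ρ] {g : E → F → G} (hg : Measurable fun p : E × F => g p.1 p.2)
    {J : E → F → ℝ≥0∞} (hJ : Measurable fun p : E × F => J p.1 p.2)
    (h : ∀ x, MeasurePreserving (g x) (ν.withDensity (J x)) ρ) :
    MeasurePreserving (fun p : E × F => (p.1, g p.1 p.2))
      ((μ.prod ν).withDensity fun p => J p.1 p.2) (μ.prod ρ) := by
  have h_meas : Measurable fun p : E × F => (p.1, g p.1 p.2) := measurable_fst.prodMk hg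
  refine ⟨h_meas, Measure.ext fun s hs => ?_⟩
  rw [Measure.map_apply h_meas hs, withDensity_apply _ (h_meas hs), Measure.prod_apply hs,
    ← lintegral_indicator (h_meas hs),
    lintegral_prod _ (hJ.indicator (h_meas hs)).aemeasurable]
  refine lintegral_congr fun x => ?_
  have h_fiber := measurable_prodMk_left (x := x) hs
  rw [← (h x).measure_preimage h_fiber.nullMeasurableSet,
    withDensity_apply _ ((h x).measurable h_fiber),
    ← lintegral_indicator ((h x).measurable h_fiber)]
  rfl

end WithDensity

variable {n : ℕ} {α : ℝ}

/-- The coefficients of the polynomial `p - iαq`, where `p` and `q` are the real monic polynomials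
of degrees `n + 1` and `n` with coefficients `x.1` and `x.2`. -/
def perturbedCoeffs (α : ℝ) (x : (Fin (n + 1) → ℝ) × (Fin n → ℝ)) : Fin (n + 1) → ℂ :=
  Fin.snoc (fun i => ⟨x.1 i.castSucc, -(α * x.2 i)⟩) ⟨x.1 (Fin.last n), -α⟩

theorem measurable_perturbedCoeffs (α : ℝ) :
    Measurable (perturbedCoeffs α : (Fin (n + 1) → ℝ) × (Fin n → ℝ) → _) := by
  have h_mk (i : Fin n) : Measurable fun x : (Fin (n + 1) → ℝ) × (Fin n → ℝ) =>
      (⟨x.1 i.castSucc, -(α * x.2 i)⟩ : ℂ) :=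
    Complex.measurableEquivRealProd.symm.measurable.comp
      (f := fun x : (Fin (n + 1) → ℝ) × (Fin n → ℝ) => (x.1 i.castSucc, -(α * x.2 i)))
      (by fun_prop)
  refine measurable_pi_lambda _ fun i => ?_
  refine Fin.lastCases ?_ (fun i => ?_) i
  · simpa only [perturbedCoeffs, Fin.snoc_last, Function.comp_def] using
      (measurable_complexMk (-α)).comp ((measurable_pi_apply (Fin.last n)).comp measurable_fst)
  · simpa only [perturbedCoeffs, Fin.snoc_castSucc] using h_mk i

theorem monicPoly_perturbedCoeffs (α : ℝ) (x : (Fin (n + 1) → ℝ) × (Fin n → ℝ)) :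
    monicPoly (perturbedCoeffs α x) = (monicPoly x.1).map (algebraMap ℝ ℂ) -
      C (Complex.I * α) * (monicPoly x.2).map (algebraMap ℝ ℂ) := by
  have h_degree : IsMonicOfDegree ((monicPoly x.1).map (algebraMap ℝ ℂ) -
      C (Complex.I * α) * (monicPoly x.2).map (algebraMap ℝ ℂ)) (n + 1) := by
    rw [map_monicPoly, map_monicPoly]
    refine (isMonicOfDegree_monicPoly _).sub ((natDegree_C_mul_le _ _).trans_lt ?_)
    rw [(isMonicOfDegree_monicPoly _).natDegree_eq]
    exact n.lt_succ_self
  rw [← monicPoly_coeff h_degree]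
  congr 1
  ext i : 1
  rw [coeff_sub, coeff_C_mul, map_monicPoly, map_monicPoly, coeff_monicPoly_fin]
  refine Fin.lastCases ?_ (fun i => ?_) i
  · rw [Fin.val_last, coeff_monicPoly_self]
    apply Complex.ext <;> simp [perturbedCoeffs]
  · rw [Fin.val_castSucc, coeff_monicPoly_fin]
    apply Complex.ext <;> simp [perturbedCoeffs]

theorem interlaced_iff_im_pos (hα : 0 < α) {x : (Fin (n + 1) → ℝ) × (Fin n → ℝ)}
    {z : Fin (n + 1) → ℂ} (hz : rootCoeffs z = perturbedCoeffs α x) :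
    Interlaced n x.1 x.2 ↔ ∀ l, 0 < (z l).im := by
  have h_poly : (monicPoly x.1).map (algebraMap ℝ ℂ) -
      C (Complex.I * α) * (monicPoly x.2).map (algebraMap ℝ ℂ) = ∏ l, (X - C (z l)) := by
    rw [← monicPoly_perturbedCoeffs, ← hz, monicPoly_rootCoeffs, Lagrange.nodal_eq]
  refine ⟨fun h l => h.im_pos hα ?_, fun h => interlaced_of_im_pos hα h h_poly⟩
  have h_root := congrArg (eval (z l)) h_poly
  rw [eval_prod, Finset.prod_eq_zero (Finset.mem_univ l) (by simp), eval_sub, eval_mul, eval_C,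
    eval_map_algebraMap, eval_map_algebraMap, sub_eq_zero] at h_root
  exact h_root

theorem measurePreserving_snoc_complexMk (hα : 0 < α) :
    MeasurePreserving (fun x : ℝ × (Fin n → ℂ) => (Fin.snoc x.2 (-⟨x.1, α⟩) : Fin (n + 1) → ℂ))
      volume (ENNReal.ofReal (α ^ n) • volume.map (perturbedCoeffs α)) := by
  have h_scale : MeasurePreserving (fun b : Fin n → ℝ => (-α) • b)
      (ENNReal.ofReal (α ^ n) • volume) volume := by
    refine ⟨by fun_prop, ?_⟩
    rw [Measure.map_smul, Measure.map_addHaar_smul _ (neg_ne_zero.mpr hα.ne'), smul_smul,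
      Module.finrank_fin_fun, abs_inv, abs_pow, abs_neg, abs_of_pos hα,
      ← ENNReal.ofReal_mul (by positivity), mul_inv_cancel₀ (by positivity), ENNReal.ofReal_one,
      one_smul]
  have h_coeffs := ((measurable_perturbedCoeffs (n := n) α).measurePreserving volume).comp
    ((measurePreserving_finSnoc.comp
      ((Measure.measurePreserving_neg (volume : Measure ℝ)).prod (.id volume))).prod
        (MeasurePreserving.id (volume : Measure (Fin n → ℝ))))
  have h_mk : MeasurePreserving
      (fun x : (ℝ × (Fin n → ℝ)) × (Fin n → ℝ) => (x.1.1, fun i => (⟨x.1.2 i, -α * x.2 i⟩ : ℂ)))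
      (ENNReal.ofReal (α ^ n) • volume) volume := by
    have h := ((MeasurePreserving.id volume).prod ((measurePreserving_complexMk n).comp
      ((MeasurePreserving.id volume).prod h_scale))).comp
        (measurePreserving_prodAssoc (volume : Measure ℝ) volume (ENNReal.ofReal (α ^ n) • volume))
    rwa [Measure.prod_smul_right] at h
  have h_comp : (fun x : ℝ × (Fin n → ℂ) => (Fin.snoc x.2 (-⟨x.1, α⟩) : Fin (n + 1) → ℂ)) ∘
      (fun x : (ℝ × (Fin n → ℝ)) × (Fin n → ℝ) => (x.1.1, fun i => (⟨x.1.2 i, -α * x.2 i⟩ : ℂ))) =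
        perturbedCoeffs α ∘ fun x => (Fin.snoc x.1.2 (-x.1.1), x.2) := by
    ext x i
    refine Fin.lastCases ?_ (fun i => ?_) i
    · apply Complex.ext <;> simp [perturbedCoeffs]
    · simp [perturbedCoeffs]
  have h_snoc : Measurable
      fun x : ℝ × (Fin n → ℂ) => (Fin.snoc x.2 (-⟨x.1, α⟩) : Fin (n + 1) → ℂ) :=
    measurePreserving_finSnoc.measurable.comp
      (((measurable_complexMk α).comp measurable_fst).neg.prodMk measurable_snd)
  rw [← h_mk.map_eq]
  refine MeasurePreserving.map_of_comp ?_ h_snoc h_mk.measurable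
  rw [h_comp]
  exact h_coeffs.smul_measure (ENNReal.ofReal (α ^ n))

theorem measurePreserving_rootCoeffs (hα : 0 < α) :
    MeasurePreserving rootCoeffs ((deltaSumIm (n + 1) α).withDensity vandermondeSq)
      (((n + 1)! : ℝ≥0∞) • ENNReal.ofReal (α ^ n) • volume.map (perturbedCoeffs α)) := by
  have h_tuple := measurePreserving_withDensity
    (measurePreserving_tupleWithSum_deltaSumIm (n := n) α) (measurable_vandermondeSq (n + 1))
  have h_meas : Measurable fun x : ℝ × (Fin n → ℂ) => lowerCoeffs (⟨x.1, α⟩ : ℂ) x.2 :=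
    (differentiable_lowerCoeffs_uncurry n).continuous.measurable.comp
      (f := fun x : ℝ × (Fin n → ℂ) => ((⟨x.1, α⟩ : ℂ), x.2))
      (((measurable_complexMk α).comp measurable_fst).prodMk measurable_snd)
  have h_lower := measurePreserving_skew_product_withDensity (volume : Measure ℝ) h_meas
    ((measurable_vandermondeSq (n + 1)).comp
      (measurePreserving_tupleWithSum_deltaSumIm α).measurable)
    fun s => measurePreserving_lowerCoeffs ⟨s, α⟩
  rw [Measure.prod_smul_right] at h_lower
  have h_snoc := ((measurePreserving_snoc_complexMk (n := n) hα).smul_measure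
    ((n + 1)! : ℝ≥0∞)).comp h_lower
  rw [← h_tuple.map_eq]
  refine MeasurePreserving.map_of_comp ?_ (measurable_rootCoeffs _) h_tuple.measurable
  have h_comp : rootCoeffs ∘ (fun x : ℝ × (Fin n → ℂ) => tupleWithSum (⟨x.1, α⟩ : ℂ) x.2) =
      (fun x : ℝ × (Fin n → ℂ) => (Fin.snoc x.2 (-⟨x.1, α⟩) : Fin (n + 1) → ℂ)) ∘
        fun x => (x.1, lowerCoeffs ⟨x.1, α⟩ x.2) :=
    _root_.funext fun x => rootCoeffs_tupleWithSum _ _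
  exact h_comp ▸ h_snoc

theorem measurableSet_im_pos (N : ℕ) : MeasurableSet {z : Fin N → ℂ | ∀ l, 0 < (z l).im} := by
  simp only [ofPred_forall]
  exact .iInter fun l => measurableSet_lt measurable_const (by fun_prop)

theorem preimage_image_rootCoeffs_im_pos (N : ℕ) :
    rootCoeffs ⁻¹' (rootCoeffs '' {z : Fin N → ℂ | ∀ l, 0 < (z l).im}) =
      {z | ∀ l, 0 < (z l).im} := by
  refine (subset_preimage_image _ _).antisymm' ?_
  rintro z ⟨w, hw, h⟩ l
  obtain ⟨σ, rfl⟩ := exists_perm_of_rootCoeffs_eq h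
  simpa using hw (σ.symm l)

theorem preimage_image_perturbedCoeffs_im_pos (hα : 0 < α) :
    perturbedCoeffs α ⁻¹' (rootCoeffs '' {z : Fin (n + 1) → ℂ | ∀ l, 0 < (z l).im}) =
      {x | Interlaced n x.1 x.2} := by
  ext x
  constructor
  · rintro ⟨z, hz, h⟩
    exact (interlaced_iff_im_pos hα h).mpr hz
  · intro hx
    obtain ⟨z, hz⟩ := rootCoeffs_surjective (n + 1) (perturbedCoeffs α x)
    exact ⟨z, (interlaced_iff_im_pos hα hz).mp hx, hz⟩

theorem measurePreserving_rootCoeffs_im_pos (hα : 0 < α) :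
    MeasurePreserving rootCoeffs
      (((deltaSumIm (n + 1) α).withDensity vandermondeSq).restrict {z | ∀ l, 0 < (z l).im})
      (((n + 1)! : ℝ≥0∞) • ENNReal.ofReal (α ^ n) •
        (interlacedMeasure n).map (perturbedCoeffs α)) := by
  have h_image : MeasurableSet (rootCoeffs '' {z : Fin (n + 1) → ℂ | ∀ l, 0 < (z l).im}) := by
    rw [← (measurable_rootCoeffs (n + 1)).measurableSet_preimage_iff_of_surjective
      (rootCoeffs_surjective (n + 1)), preimage_image_rootCoeffs_im_pos]
    exact measurableSet_im_pos (n + 1)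
  have h := (measurePreserving_rootCoeffs (n := n) hα).restrict_preimage h_image
  rwa [preimage_image_rootCoeffs_im_pos, Measure.restrict_smul, Measure.restrict_smul,
    Measure.restrict_map (measurable_perturbedCoeffs α) h_image,
    preimage_image_perturbedCoeffs_im_pos hα] at h

end PerturbedCoeffs

section Trace

open Polynomial Matrix

theorem charpoly_mul_self_eval_sq {m R : Type*} [Fintype m] [DecidableEq m] [CommRing R]
    (M : Matrix m m R) (t : R) : (M * M).charpoly.eval (t ^ 2) =
      (-1) ^ Fintype.card m * (M.charpoly.eval t * M.charpoly.eval (-t)) := by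
  have h_factor : scalar m (t ^ 2) - M * M = -((scalar m t - M) * (scalar m (-t) - M)) := by
    have h_comm := (scalar_commute t (fun _ => Commute.all _ _) M).eq
    rw [map_neg, sq, map_mul, sub_mul, mul_sub, mul_sub, mul_neg, mul_neg, h_comm]
    abel
  rw [eval_charpoly, eval_charpoly, eval_charpoly, ← det_mul, ← det_neg, h_factor]

theorem trace_mul_self_eq_sum_sq {N : ℕ} {M : Matrix (Fin N) (Fin N) ℂ} {z : Fin N → ℂ}
    (hz : M.charpoly.roots = Finset.univ.val.map z) : (M * M).trace = ∑ l, z l ^ 2 := by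
  have h_charpoly : (M * M).charpoly = Lagrange.nodal Finset.univ fun l => z l ^ 2 := by
    refine Polynomial.funext fun s => ?_
    obtain ⟨t, rfl⟩ : ∃ t : ℂ, s = t ^ 2 := (IsAlgClosed.exists_pow_nat_eq s two_pos).imp
      fun _ h => h.symm
    rw [charpoly_mul_self_eval_sq, ← nodal_univ_eq_of_roots_eq M.charpoly_monic hz,
      Lagrange.eval_nodal, Lagrange.eval_nodal, Lagrange.eval_nodal, ← Finset.card_univ,
      ← Finset.prod_const, ← Finset.prod_mul_distrib, ← Finset.prod_mul_distrib]
    exact Finset.prod_congr rfl fun l _ => by ring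
  rw [trace_eq_sum_roots_charpoly, h_charpoly, roots_nodal_univ]
  rfl

theorem im_trace_mul_of_isHermitian {m : Type*} [Fintype m] {A B : Matrix m m ℂ}
    (hA : A.IsHermitian) (hB : B.IsHermitian) : (A * B).trace.im = 0 := by
  have h := trace_conjTranspose (A * B)
  rw [conjTranspose_mul, hA.eq, hB.eq, trace_mul_comm] at h
  exact Complex.conj_eq_iff_im.mp h.symm

theorem re_trace_mul_self {N : ℕ} {A : Matrix (Fin N) (Fin N) ℂ} (hA : A.IsHermitian)
    {v : Fin N → ℂ} (hv : v ⬝ᵥ star v = 1) {α : ℝ} {z : Fin N → ℂ}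
    (hz : (A + (Complex.I * α) • vecMulVec v (star v)).charpoly.roots = Finset.univ.val.map z) :
    (A * A).trace.re = ∑ l, ((z l).re ^ 2 - (z l).im ^ 2) + α ^ 2 := by
  set V := vecMulVec v (star v) with hV
  have h_proj : (V * V).trace = 1 := by
    rw [hV, vecMulVec_mul_vecMulVec, dotProduct_comm (star v), hv, one_smul, trace_vecMulVec, hv]
  have h_cross : (A * V).trace.im = 0 :=
    im_trace_mul_of_isHermitian hA (isHermitian_vecMulVec_star v)
  have h_expand : ((A + (Complex.I * α) • V) * (A + (Complex.I * α) • V)).trace =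
      (A * A).trace + 2 * (Complex.I * α) * (A * V).trace + (Complex.I * α) ^ 2 := by
    simp only [add_mul, mul_add, smul_mul_assoc, mul_smul_comm, smul_smul, smul_add, trace_add,
      trace_smul, smul_eq_mul, trace_mul_comm V A, h_proj]
    ring
  have h_re := congrArg Complex.re ((trace_mul_self_eq_sum_sq hz).symm.trans h_expand)
  have h_sum : (∑ l, z l ^ 2).re = ∑ l, ((z l).re ^ 2 - (z l).im ^ 2) := by
    rw [Complex.re_sum]
    exact Finset.sum_congr rfl fun l _ => by simp [sq]
  have h_square : ((Complex.I * α) ^ 2).re = -α ^ 2 := by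
    rw [mul_pow, Complex.I_sq, neg_one_mul, ← Complex.ofReal_pow, Complex.neg_re, Complex.ofReal_re]
  have h_mixed : (2 * (Complex.I * α) * (A * V).trace).re = 0 := by simp [h_cross]
  rw [h_sum, Complex.add_re, Complex.add_re, h_mixed, h_square] at h_re
  linarith

theorem charpoly_perturbation {n : ℕ} {A : Matrix (Fin (n + 1)) (Fin (n + 1)) ℂ}
    (hA : A.IsHermitian) {v : Fin (n + 1) → ℂ} (hv : v ⬝ᵥ star v = 1) (α : ℝ) :
    (A + (Complex.I * α) • vecMulVec v (star v)).charpoly =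
      monicPoly (perturbedCoeffs α (spectralPair A v)) := by
  have h_length : (sqLength v : ℂ) = 1 := (dotProduct_star_self v).symm.trans hv
  have hv_ne : v ≠ 0 := by rintro rfl; simp at hv
  have h_resolvent := C_mul_map_monicPoly_resolventCoeffs hA hv_ne
  rw [h_length, C_1, one_mul] at h_resolvent
  rw [charpoly_add_smul_vecMulVec_star, monicPoly_perturbedCoeffs, spectralPair,
    map_monicPoly_charCoeffs hA, h_resolvent]

end Trace

section EigenvalueLaw

open Set Polynomial Matrix
open scoped ENNReal Nat

theorem prod_norm_sq_eq_vandermonde {N : ℕ} (z : Fin N → ℂ) :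
    ∏ j, ∏ k ∈ Finset.Ioi j, ‖z k - z j‖ ^ 2 = ‖(vandermonde z).det‖ ^ 2 := by
  simp only [det_vandermonde, norm_prod, Finset.prod_pow]

theorem norm_det_vandermonde_comp_perm {N : ℕ} (z : Fin N → ℂ) (σ : Equiv.Perm (Fin N)) :
    ‖(vandermonde (z ∘ σ)).det‖ = ‖(vandermonde z).det‖ := by
  have h_rows : vandermonde (z ∘ σ) = (vandermonde z).submatrix σ id := rfl
  rw [h_rows, det_permute, norm_mul]
  rcases Int.units_eq_one_or (Equiv.Perm.sign σ) with h | h <;> simp [h]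

theorem eigenvalueWeight_comp_perm {N : ℕ} (α : ℝ) (z : Fin N → ℂ) (σ : Equiv.Perm (Fin N)) :
    eigenvalueWeight N α (z ∘ σ) = eigenvalueWeight N α z := by
  rw [eigenvalueWeight, eigenvalueWeight, prod_norm_sq_eq_vandermonde, prod_norm_sq_eq_vandermonde,
    norm_det_vandermonde_comp_perm]
  congr 2
  exact Equiv.prod_comp σ fun l => Real.exp (-((z l).re ^ 2 - (z l).im ^ 2))

theorem measurable_eigenvalueWeight (N : ℕ) (α : ℝ) : Measurable (eigenvalueWeight N α) := by
  unfold eigenvalueWeight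
  fun_prop

theorem measurePreserving_comp_perm_eigenvalueMeasure {N : ℕ} [NeZero N] (C α : ℝ)
    (σ : Equiv.Perm (Fin N)) :
    MeasurePreserving (fun z => z ∘ σ) (eigenvalueMeasure N C α) (eigenvalueMeasure N C α) := by
  have h_preimage : (fun z : Fin N → ℂ => z ∘ σ) ⁻¹' {z | ∀ l, 0 < (z l).im} =
      {z | ∀ l, 0 < (z l).im} :=
    Set.ext fun z => ⟨fun h l => by simpa using h (σ.symm l), fun h l => h (σ l)⟩
  have h_restrict := (measurePreserving_comp_perm_deltaSumIm α σ).restrict_preimage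
    (measurableSet_im_pos N)
  rw [h_preimage] at h_restrict
  rw [eigenvalueMeasure]
  simpa only [eigenvalueWeight_comp_perm] using measurePreserving_withDensity h_restrict
    ((measurable_eigenvalueWeight N α).const_mul C).ennreal_ofReal

theorem exists_comp_rootCoeffs {m : ℕ} {f : (Fin m → ℂ) → ℝ≥0∞} (hf : Measurable f)
    (h_symm : ∀ (σ : Equiv.Perm (Fin m)) z, f (z ∘ σ) = f z) :
    ∃ F : (Fin m → ℂ) → ℝ≥0∞, Measurable F ∧ ∀ z, F (rootCoeffs z) = f z := by
  have h_factors : Function.FactorsThrough f rootCoeffs := by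
    intro z w h
    obtain ⟨σ, rfl⟩ := exists_perm_of_rootCoeffs_eq h
    exact h_symm σ w
  have h_extend := h_factors.extend_apply 0
  refine ⟨Function.extend rootCoeffs f 0, ?_, h_extend⟩
  rw [← (measurable_rootCoeffs m).measurable_comp_iff_of_surjective (rootCoeffs_surjective m)]
  rwa [show Function.extend rootCoeffs f 0 ∘ rootCoeffs = f from _root_.funext h_extend]

theorem isEigenvalueLaw_of_hasLaw_coeffs {Ω : Type*} [MeasurableSpace Ω] {P : Measure Ω} {N : ℕ}
    {M : Ω → Matrix (Fin N) (Fin N) ℂ} {X : Ω → Fin N → ℂ} {ν μ : Measure (Fin N → ℂ)}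
    (hX : HasLaw X ν P) (h_charpoly : ∀ ω, (M ω).charpoly = monicPoly (X ω))
    (h_coeffs : MeasurePreserving rootCoeffs μ ν)
    (h_symm : ∀ σ : Equiv.Perm (Fin N), μ.map (fun z => z ∘ σ) = μ) : IsEigenvalueLaw M P μ := by
  refine ⟨h_symm, fun z hz f hf hf_symm => ?_⟩
  obtain ⟨F, hF, hFf⟩ := exists_comp_rootCoeffs hf hf_symm
  have h_root (ω : Ω) : rootCoeffs (z ω) = X ω := by
    refine monicPoly_injective ?_
    rw [monicPoly_rootCoeffs, nodal_univ_eq_of_roots_eq (M ω).charpoly_monic (hz ω), h_charpoly]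
  calc ∫⁻ ω, f (z ω) ∂P = ∫⁻ ω, F (X ω) ∂P := by simp only [← hFf, h_root]
    _ = ∫⁻ c, F c ∂ν := hX.lintegral_comp hF.aemeasurable
    _ = ∫⁻ w, F (rootCoeffs w) ∂μ := (h_coeffs.lintegral_comp hF).symm
    _ = ∫⁻ w, f w ∂μ := by simp only [hFf]

end EigenvalueLaw

section GUE

open Set Matrix
open scoped ENNReal Nat

theorem re_trace_mul_self_eq_sum_norm_sq {m : Type*} [Fintype m] {A : Matrix m m ℂ}
    (hA : A.IsHermitian) : (A * A).trace.re = ∑ p : m × m, ‖A p.1 p.2‖ ^ 2 := by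
  rw [Fintype.sum_prod_type, trace, Complex.re_sum]
  refine Finset.sum_congr rfl fun i _ => ?_
  rw [diag_apply, mul_apply, Complex.re_sum]
  refine Finset.sum_congr rfl fun j _ => ?_
  rw [← hA.apply j i, RCLike.star_def, Complex.mul_conj, Complex.ofReal_re,
    Complex.normSq_eq_norm_sq]

theorem sum_sq_entries_le_re_trace_mul_self {N : ℕ} (h : HermitianEntries N) :
    ∑ i, h.1 i ^ 2 + ∑ p, ‖h.2 p‖ ^ 2 ≤
      (hermitianOfEntries N h * hermitianOfEntries N h).trace.re := by
  have h_diag : ∑ i, h.1 i ^ 2 = ∑ p : Fin N × Fin N with p.1 = p.2,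
      ‖hermitianOfEntries N h p.1 p.2‖ ^ 2 := by
    refine Finset.sum_nbij' (fun i => (i, i)) Prod.fst (by simp) (by simp) (by simp) ?_ ?_
    · rintro ⟨i, j⟩ hij
      exact Prod.ext rfl (Finset.mem_filter.mp hij).2
    · simp [hermitianOfEntries]
  have h_upper : ∑ p, ‖h.2 p‖ ^ 2 = ∑ p : Fin N × Fin N with p.1 < p.2,
      ‖hermitianOfEntries N h p.1 p.2‖ ^ 2 := by
    rw [Finset.sum_subtype (p := fun p : Fin N × Fin N => p.1 < p.2) _ (by simp)]
    exact Finset.sum_congr rfl fun p _ => by simp [hermitianOfEntries, p.2]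
  have h_disjoint : Disjoint (Finset.univ.filter fun p : Fin N × Fin N => p.1 = p.2)
      (Finset.univ.filter fun p => p.1 < p.2) :=
    Finset.disjoint_filter.mpr fun _ _ h_eq h_lt => h_lt.ne h_eq
  rw [re_trace_mul_self_eq_sum_norm_sq (isHermitian_hermitianOfEntries h), h_diag, h_upper,
    ← Finset.sum_union h_disjoint]
  exact Finset.sum_le_sum_of_subset_of_nonneg (Finset.subset_univ _) fun _ _ _ => sq_nonneg _

theorem integrable_exp_neg_norm_sq {V : Type*} [NormedAddCommGroup V] [InnerProductSpace ℝ V]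
    [FiniteDimensional ℝ V] [MeasurableSpace V] [BorelSpace V] :
    Integrable fun z : V => Real.exp (-‖z‖ ^ 2) := by
  have h := GaussianFourier.integrable_cexp_neg_mul_sq_norm_add (b := 1) (by simp) 0 (0 : V)
  refine h.norm.congr (Filter.Eventually.of_forall fun z => ?_)
  simp [Complex.norm_exp, ← Complex.ofReal_pow]

theorem measurable_gueDensity (N : ℕ) : Measurable fun h : HermitianEntries N =>
    ENNReal.ofReal (Real.exp (-(hermitianOfEntries N h * hermitianOfEntries N h).trace.re)) := by
  have h_continuous := continuous_hermitianOfEntries N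
  exact (Complex.continuous_re.comp
    (h_continuous.matrix_mul h_continuous).matrix_trace).neg.rexp.measurable.ennreal_ofReal

theorem gueWeight_univ_ne_top (N : ℕ) : gueWeight N univ ≠ ∞ := by
  have h_diag : Integrable fun x : Fin N → ℝ => ∏ i, Real.exp (-‖x i‖ ^ 2) :=
    Integrable.fintype_prod fun _ => integrable_exp_neg_norm_sq
  have h_upper : Integrable fun x : {p : Fin N × Fin N // p.1 < p.2} → ℂ =>
      ∏ p, Real.exp (-‖x p‖ ^ 2) :=
    Integrable.fintype_prod fun _ => integrable_exp_neg_norm_sq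
  rw [gueWeight, withDensity_apply _ MeasurableSet.univ, Measure.restrict_univ]
  refine ne_top_of_le_ne_top (h_diag.mul_prod h_upper).lintegral_lt_top.ne
    (lintegral_mono fun h => ENNReal.ofReal_le_ofReal ?_)
  simp only [← Real.exp_sum, ← Real.exp_add, Real.exp_le_exp, Finset.sum_neg_distrib, ← neg_add,
    neg_le_neg_iff, Real.norm_eq_abs, sq_abs]
  exact sum_sq_entries_le_re_trace_mul_self h

theorem gueWeight_univ_ne_zero (N : ℕ) : gueWeight N univ ≠ 0 := by
  have h_support : (Function.support fun h : HermitianEntries N => ENNReal.ofReal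
      (Real.exp (-(hermitianOfEntries N h * hermitianOfEntries N h).trace.re))) = univ :=
    eq_univ_of_forall fun h => (ENNReal.ofReal_pos.mpr (Real.exp_pos _)).ne'
  rw [gueWeight, withDensity_apply _ MeasurableSet.univ, Measure.restrict_univ, ← pos_iff_ne_zero,
    lintegral_pos_iff_support (measurable_gueDensity N), h_support]
  exact isOpen_univ.measure_pos _ univ_nonempty

/-- The density `exp (-Tr A²)` of the GUE in terms of the eigenvalues `z` of the matrix
`A + iα v v†`, where `v` is a unit vector. -/
noncomputable def gueDensity {N : ℕ} (α : ℝ) (z : Fin N → ℂ) : ℝ≥0∞ :=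
  ENNReal.ofReal (Real.exp (-(∑ l, ((z l).re ^ 2 - (z l).im ^ 2) + α ^ 2)))

theorem exists_gueDensity_comp_rootCoeffs (N : ℕ) (α : ℝ) :
    ∃ W : (Fin N → ℂ) → ℝ≥0∞, Measurable W ∧ ∀ z, W (rootCoeffs z) = gueDensity α z := by
  refine exists_comp_rootCoeffs (by unfold gueDensity; fun_prop) fun σ z => ?_
  rw [gueDensity, gueDensity, ← Equiv.sum_comp σ fun l => (z l).re ^ 2 - (z l).im ^ 2]
  rfl

variable {n : ℕ} {α : ℝ} {v : Fin (n + 1) → ℂ} {W : (Fin (n + 1) → ℂ) → ℝ≥0∞}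

theorem apply_perturbedCoeffs_spectralPair (hW : ∀ z, W (rootCoeffs z) = gueDensity α z)
    {A : Matrix (Fin (n + 1)) (Fin (n + 1)) ℂ} (hA : A.IsHermitian) (hv : v ⬝ᵥ star v = 1) :
    W (perturbedCoeffs α (spectralPair A v)) =
      ENNReal.ofReal (Real.exp (-(A * A).trace.re)) := by
  obtain ⟨z, hz⟩ := rootCoeffs_surjective (n + 1) (perturbedCoeffs α (spectralPair A v))
  have h_roots : (A + (Complex.I * α) • vecMulVec v (star v)).charpoly.roots =
      Finset.univ.val.map z := by
    rw [charpoly_perturbation hA hv, ← hz, monicPoly_rootCoeffs, roots_nodal_univ]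
  rw [← hz, hW, gueDensity, re_trace_mul_self hA hv h_roots]

theorem measurePreserving_perturbedCoeffs_gueWeight {c : ℝ≥0∞}
    (h_pair : MeasurePreserving (fun h => spectralPair (hermitianOfEntries (n + 1) h) v) volume
      (c • interlacedMeasure n))
    (hv : v ⬝ᵥ star v = 1) (hW_meas : Measurable W)
    (hW : ∀ z, W (rootCoeffs z) = gueDensity α z) :
    MeasurePreserving
      (fun h => perturbedCoeffs α (spectralPair (hermitianOfEntries (n + 1) h) v))
      (gueWeight (n + 1)) (c • ((interlacedMeasure n).map (perturbedCoeffs α)).withDensity W) := by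
  have h := measurePreserving_withDensity
    (((measurable_perturbedCoeffs α).measurePreserving _).comp h_pair) hW_meas
  simp only [Function.comp_apply,
    apply_perturbedCoeffs_spectralPair hW (isHermitian_hermitianOfEntries _) hv] at h
  rwa [Measure.map_smul, withDensity_smul_measure] at h

theorem eigenvalueMeasure_eq_withDensity_gueDensity (hα : 0 < α) {C : ℝ} (hC : 0 ≤ C) :
    eigenvalueMeasure (n + 1) C α = ENNReal.ofReal (C / α ^ n) •
      (((deltaSumIm (n + 1) α).withDensity vandermondeSq).restrict
        {z | ∀ l, 0 < (z l).im}).withDensity (gueDensity α) := by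
  have h_density (z : Fin (n + 1) → ℂ) : ENNReal.ofReal (C * eigenvalueWeight (n + 1) α z) =
      (ENNReal.ofReal (C / α ^ n) •
        (vandermondeSq * gueDensity α : (Fin (n + 1) → ℂ) → ℝ≥0∞)) z := by
    rw [Pi.smul_apply, smul_eq_mul, Pi.mul_apply, vandermondeSq, gueDensity,
      ← ENNReal.ofReal_mul (by positivity), ← ENNReal.ofReal_mul (by positivity),
      eigenvalueWeight, prod_norm_sq_eq_vandermonde, ← Real.exp_sum, neg_add, Real.exp_add,
      Finset.sum_neg_distrib, Nat.add_sub_cancel]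
    congr 1
    field_simp
  have h_gue : Measurable (gueDensity α : (Fin (n + 1) → ℂ) → ℝ≥0∞) := by
    unfold gueDensity; fun_prop
  simp only [eigenvalueMeasure, h_density]
  rw [restrict_withDensity (measurableSet_im_pos _), ← withDensity_mul _
    (measurable_vandermondeSq _) h_gue,
    ← withDensity_smul _ ((measurable_vandermondeSq _).mul h_gue)]

theorem measurePreserving_rootCoeffs_eigenvalueMeasure (hα : 0 < α) {C : ℝ} (hC : 0 ≤ C)
    (hW_meas : Measurable W) (hW : ∀ z, W (rootCoeffs z) = gueDensity α z) :
    MeasurePreserving rootCoeffs (eigenvalueMeasure (n + 1) C α)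
      ((ENNReal.ofReal C * (n + 1)!) •
        ((interlacedMeasure n).map (perturbedCoeffs α)).withDensity W) := by
  have h_const : ENNReal.ofReal (C / α ^ n) * ((n + 1)! * ENNReal.ofReal (α ^ n)) =
      ENNReal.ofReal C * (n + 1)! := by
    rw [mul_left_comm, ← ENNReal.ofReal_mul (by positivity), div_mul_cancel₀ _ (by positivity),
      mul_comm]
  have h := (measurePreserving_withDensity (measurePreserving_rootCoeffs_im_pos hα)
    hW_meas).smul_measure (ENNReal.ofReal (C / α ^ n))
  simp only [hW] at h
  rw [smul_smul, withDensity_smul_measure, smul_smul, h_const] at h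
  rw [eigenvalueMeasure_eq_withDensity_gueDensity hα hC]
  exact h

theorem isEigenvalueLaw_add_smul_vecMulVec {c : ℝ≥0∞} (hc : c ≠ ∞)
    (h_pair : MeasurePreserving (fun h => spectralPair (hermitianOfEntries (n + 1) h) v) volume
      (c • interlacedMeasure n))
    (hv : v ⬝ᵥ star v = 1) (hα : 0 < α) {Ω : Type*} [MeasurableSpace Ω] {P : Measure Ω}
    {A : Ω → Matrix (Fin (n + 1)) (Fin (n + 1)) ℂ} (hA : IsGUE (n + 1) A P) :
    IsEigenvalueLaw (fun ω => A ω + (Complex.I * α) • vecMulVec v (star v)) P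
      (eigenvalueMeasure (n + 1) ((gueWeight (n + 1) univ)⁻¹ * c / (n + 1)!).toReal α) := by
  obtain ⟨h, h_law, h_matrix⟩ := hA
  obtain ⟨W, hW_meas, hW⟩ := exists_gueDensity_comp_rootCoeffs (n + 1) α
  have h_factorial : ((n + 1)! : ℝ≥0∞) ≠ 0 := Nat.cast_ne_zero.mpr (n + 1).factorial_ne_zero
  have h_const : ENNReal.ofReal ((gueWeight (n + 1) univ)⁻¹ * c / (n + 1)!).toReal * (n + 1)! =
      (gueWeight (n + 1) univ)⁻¹ * c := by
    rw [ENNReal.ofReal_toReal (ENNReal.div_ne_top (ENNReal.mul_ne_top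
      (ENNReal.inv_ne_top.mpr (gueWeight_univ_ne_zero _)) hc) h_factorial),
      ENNReal.div_mul_cancel h_factorial (ENNReal.natCast_ne_top _)]
  have h_coeffs := (measurePreserving_perturbedCoeffs_gueWeight h_pair hv hW_meas hW).smul_measure
    (gueWeight (n + 1) univ)⁻¹
  have h_roots := measurePreserving_rootCoeffs_eigenvalueMeasure (n := n) hα
    (ENNReal.toReal_nonneg (a := (gueWeight (n + 1) univ)⁻¹ * c / (n + 1)!)) hW_meas hW
  rw [h_const, ← smul_smul] at h_roots
  refine isEigenvalueLaw_of_hasLaw_coeffs (h_coeffs.hasLaw.comp h_law) (fun ω => ?_) h_roots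
    fun σ => (measurePreserving_comp_perm_eigenvalueMeasure _ α σ).map_eq
  rw [h_matrix, charpoly_perturbation (isHermitian_hermitianOfEntries _) hv, Function.comp_apply]

theorem diagOne_eq_vecMulVec (N : ℕ) [NeZero N] :
    diagOne N = vecMulVec (Pi.single 0 1) (star (Pi.single 0 1)) := by
  ext i j
  rw [diagOne, vecMulVec_apply, diagonal_apply]
  by_cases hi : i = 0 <;> by_cases hj : j = 0 <;> simp [hi, hj, eq_comm]

theorem unitOnes_dotProduct_star (N : ℕ) [NeZero N] : unitOnes N ⬝ᵥ star (unitOnes N) = 1 := by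
  simp only [dotProduct, unitOnes, Pi.star_apply, RCLike.star_def, Complex.conj_ofReal,
    Finset.sum_const, Finset.card_univ, Fintype.card_fin, nsmul_eq_mul]
  norm_cast
  rw [div_mul_div_comm, one_mul, Real.mul_self_sqrt N.cast_nonneg,
    mul_one_div_cancel (Nat.cast_ne_zero.mpr (NeZero.ne N))]

end GUE

end PerturbedGUE

open PerturbedGUE Matrix in
theorem proposition4p1_general (N : ℕ) [NeZero N] :
    ∃ C : ℝ, 0 < C ∧ ∀ α : ℝ, 0 < α → ∀ v : Fin N → ℂ, v ⬝ᵥ star v = 1 →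
      ∀ (Ω : Type*) [MeasurableSpace Ω] (P : Measure Ω) (A : Ω → Matrix (Fin N) (Fin N) ℂ),
        IsGUE N A P → IsEigenvalueLaw (fun ω => A ω + (Complex.I * α) • vecMulVec v (star v)) P
          (eigenvalueMeasure N C α) := by
  obtain ⟨n, rfl⟩ := Nat.exists_eq_succ_of_ne_zero (NeZero.ne N)
  obtain ⟨c, hc_ne_zero, hc_ne_top, h_pair⟩ := exists_measurePreserving_spectralPair n
  have h_factorial : ((n + 1).factorial : ENNReal) ≠ 0 :=
    Nat.cast_ne_zero.mpr (n + 1).factorial_ne_zero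
  refine ⟨((gueWeight (n + 1) Set.univ)⁻¹ * c / (n + 1).factorial).toReal,
    ENNReal.toReal_pos ?_ ?_, fun α hα v hv Ω _ P A hA => ?_⟩
  · exact ENNReal.div_ne_zero.mpr ⟨mul_ne_zero (ENNReal.inv_ne_zero.mpr (gueWeight_univ_ne_top _))
      hc_ne_zero, ENNReal.natCast_ne_top _⟩
  · exact ENNReal.div_ne_top (ENNReal.mul_ne_top (ENNReal.inv_ne_top.mpr (gueWeight_univ_ne_zero _))
      hc_ne_top) h_factorial
  · refine isEigenvalueLaw_add_smul_vecMulVec hc_ne_top (h_pair v ?_) hv hα hA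
    rintro rfl
    simp at hv

theorem proposition4p1 (N : ℕ) [NeZero N] :
    ∃ C : ℝ, 0 < C ∧ ∀ α : ℝ, 0 < α →
      ∀ (Ω : Type*) [MeasurableSpace Ω] (P : Measure Ω) [IsProbabilityMeasure P]
        (A : Ω → Matrix (Fin N) (Fin N) ℂ), PerturbedGUE.IsGUE N A P →
        PerturbedGUE.IsEigenvalueLaw
          (fun ω => A ω + (Complex.I * (α : ℂ)) • PerturbedGUE.diagOne N) P
          (PerturbedGUE.eigenvalueMeasure N C α) ∧
        PerturbedGUE.IsEigenvalueLaw
          (fun ω => A ω + (Complex.I * (α : ℂ)) • PerturbedGUE.onesProjection N) P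
          (PerturbedGUE.eigenvalueMeasure N C α) := by
  obtain ⟨C, hC, h_law⟩ := proposition4p1_general N
  refine ⟨C, hC, fun α hα Ω _ P _ A hA => ⟨?_, ?_⟩⟩
  · rw [PerturbedGUE.diagOne_eq_vecMulVec]
    exact h_law α hα _ (by simp) Ω P A hA
  · exact h_law α hα _ (PerturbedGUE.unitOnes_dotProduct_star N) Ω P A hA
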